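/- Let $\gamma>0$ and $0\le M<\infty$. There are constants $K_1,K_2>0$, depending only on $\gamma$ and $M$, such that the following holds. Let $2\le i\le r$ be integers, let $(S,\mathcal S)$ be a measurable space, let $h\colon S^r\to\mathbb R$ be measurable (for the product $\sigma$-algebra) and symmetric, i.e. invariant under permutations of its $r$ arguments, and let $(X_k)_{k\ge1}$ be an i.i.d. sequence of $S$-valued random variables on a probability space. Put $$U_n:=\sum_{1\le k_1<\dots<k_r\le n}h(X_{k_1},\dots,X_{k_r}).$$ Suppose that $h$ is degenerate of order $i-1$, i.e. $Y:=h(X_1,\dots,X_r)$ is integrable, $\mathbb E[Y\mid X_1,\dots,X_{i-1}]=0$ almost surely, and $\mathbb E[Y\mid X_1,\dots,X_i]$ is not almost surely equal to $0$. Suppose also that $$\sup_{t>0}\exp(t^\gamma)\,\mathbb P\bigl(|h(X_1,\dots,X_r)|>t\bigr)=M.$$ Then for every integer $N\ge r$ and every $x>0$, $$\mathbb P\Bigl(\max_{r\le n\le N}|U_n|>N^r x\Bigr)\le K_1\exp\Bigl(-K_2\,N^{\frac{i\gamma}{2+i\gamma}}\,x^{\frac{2\gamma}{2+i\gamma}}\Bigr).$$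 -/

import Mathlib

open MeasureTheory ProbabilityTheory
open scoped ENNReal NNReal

namespace UStat

/-- The kernel `h` of `r` variables is invariant under all permutations of its arguments. -/
def IsSymmetric {S : Type*} {r : ℕ} (h : (Fin r → S) → ℝ) : Prop :=
  ∀ (σ : Equiv.Perm (Fin r)) (s : Fin r → S), h (fun j => s (σ j)) = h s

/-- Independent, identically distributed, measurable `S`-valued random variables. The sequence
is indexed from `0`: `X 0, X 1, …` are the variables usually written `X₁, X₂, …`. -/
structure IsIID {Ω S : Type*} [MeasurableSpace Ω] [MeasurableSpace S]
    (X : ℕ → Ω → S) (μ : Measure Ω) : Prop where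
  measurable : ∀ k, Measurable (X k)
  indep : iIndepFun X μ
  identDistrib : ∀ k, IdentDistrib (X k) (X 0) μ μ

/-- The random variable `h(X₁, …, X_r)`. -/
def kernelVar {Ω S : Type*} {r : ℕ} (h : (Fin r → S) → ℝ) (X : ℕ → Ω → S) (ω : Ω) : ℝ :=
  h (fun j => X j ω)

open Classical in
/-- The index set of strictly increasing `r`-tuples with entries among the first `n` indices. -/
noncomputable def indexSet (r n : ℕ) : Finset (Fin r → Fin n) :=
  Finset.univ.filter (fun i => StrictMono i)

/-- The (unnormalized) U-statistic `U_n = ∑_{i₁ < ⋯ < i_r ≤ n} h(X_{i₁}, …, X_{i_r})`. -/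
noncomputable def uStat {Ω S : Type*} {r : ℕ} (h : (Fin r → S) → ℝ) (X : ℕ → Ω → S)
    (n : ℕ) (ω : Ω) : ℝ :=
  ∑ i ∈ indexSet r n, h (fun j => X (i j) ω)

/-- The `σ`-algebra generated by the first `j` variables of the sequence. -/
abbrev sigmaFirst {Ω S : Type*} [MeasurableSpace S] (X : ℕ → Ω → S) (j : ℕ) : MeasurableSpace Ω :=
  ⨆ k ∈ Finset.range j, MeasurableSpace.comap (X k) inferInstance

/-- `Y = h(X₁, …, X_r)` is integrable, its conditional expectation given the first `d` variables
vanishes almost surely, and the one given the first `d + 1` variables does not. -/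
structure IsDegenerateOfOrder {Ω S : Type*} [MeasurableSpace Ω] [MeasurableSpace S] {r : ℕ}
    (h : (Fin r → S) → ℝ) (X : ℕ → Ω → S) (μ : Measure Ω) (d : ℕ) : Prop where
  integrable : Integrable (kernelVar h X) μ
  condExp_eq_zero : μ[kernelVar h X | sigmaFirst X d] =ᵐ[μ] 0
  condExp_ne_zero : ¬ (μ[kernelVar h X | sigmaFirst X (d + 1)] =ᵐ[μ] 0)

/-- `sup_{t > 0} exp(t ^ γ) P(|h(X₁, …, X_r)| > t)`, as an extended non-negative number. -/
noncomputable def tailSup {Ω S : Type*} [MeasurableSpace Ω] {r : ℕ}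
    (h : (Fin r → S) → ℝ) (X : ℕ → Ω → S) (μ : Measure Ω) (γ : ℝ) : ℝ≥0∞ :=
  ⨆ (t : ℝ) (_ : 0 < t),
    ENNReal.ofReal (Real.exp (t ^ γ)) * μ {ω | t < |kernelVar h X ω|}

/-- `max_{r ≤ n ≤ N} |U_n|`. -/
noncomputable def maxUStat {Ω S : Type*} {r : ℕ} (h : (Fin r → S) → ℝ) (X : ℕ → Ω → S)
    {N : ℕ} (hN : r ≤ N) (ω : Ω) : ℝ :=
  (Finset.Icc r N).sup' (Finset.nonempty_Icc.2 hN) (fun n => |uStat h X n ω|)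

end UStat

namespace UStat

universe u v

/-! The proof is a moment method: moments of order `2m` are bounded with explicit dependence on `m`,
a maximal inequality turns them into a tail bound, and `m` is then chosen.

Write `i = d + 1`. Splitting off the last variable, `U_{n+1}(h)` equals `U_n(h)` plus the
U-statistic of the section `h(·, X_{n+1})`. The section is the sum of `marginal`, where the last
argument is integrated out, and `centered`, which has mean zero in the new variable and so
contributes a martingale increment. Since `L^{2m}` is 2-smooth with constant `4m`
(`lpNorm_add_sq_le`), such increments add in squares instead of linearly. The centered kernel has
one argument fewer, one parameter more, and one order of degeneracy fewer, so induction over `n`,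
for all kernels and parameter spaces at once, gives `‖U_n‖² ≤ (16m)^i n^(2r-i) ‖h‖²` in `L^{2m}`
(`lpNorm_usum_sq_le`): each order of degeneracy trades a factor `n` for `16m`.

For the maximum, `U_n` is written as a martingale plus a drift made of U-statistics of the marginal
kernel (`usum_initial_eq`). Doob's inequality handles the martingale. The drift is replaced by the
sum of absolute values, and Minkowski's inequality already gives the same power of `N`
(`measureReal_max_usum_le`).

The tail hypothesis gives `‖Y‖² ≤ A₀ m^(2/γ)` in `L^{2m}` (`memLp_of_tail`). The probability is
therefore at most `2 (4 A₀ 16^i m^(i + 2/γ) / (N^i x²))^m`. An `m` of order `(N^i x²)^(γ/(2 + iγ))`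
keeps the bracket below `exp (-2)`, and this order is the exponent claimed (`rpow_optimal_scale`,
`exists_moment_le`). -/

/-! ### A two-point inequality for even powers. -/

/-- Passing from `j` to `j + 1` multiplies the quotient of the two binomial coefficients by `(2m -
2j - 1) / (2j + 1)`, which is at most `2m`. -/
theorem choose_two_mul_le (m j : ℕ) :
    (Nat.choose (2 * m) (2 * j) : ℝ) ≤ (Nat.choose m j : ℝ) * (2 * m : ℝ) ^ j := by
  induction j with
  | zero => simp
  | succ j ih =>
    rcases lt_or_ge m (j + 1) with hlt | hle
    · rw [Nat.choose_eq_zero_of_lt (show 2 * m < 2 * (j + 1) by omega)]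
      rw [Nat.cast_zero]
      positivity
    · have h1 := Nat.choose_succ_right_eq (2 * m) (2 * j)
      have h2 := Nat.choose_succ_right_eq (2 * m) (2 * j + 1)
      have h3 := Nat.choose_succ_right_eq m j
      obtain ⟨k, rfl⟩ := Nat.exists_eq_add_of_le hle
      have e1 : 2 * (j + 1 + k) - 2 * j = 2 * k + 2 := by omega
      have e2 : 2 * (j + 1 + k) - (2 * j + 1) = 2 * k + 1 := by omega
      have e3 : j + 1 + k - j = k + 1 := by omega
      rw [e1] at h1
      rw [e2] at h2
      rw [e3] at h3
      have h1' : ((2 * (j + 1 + k)).choose (2 * j + 1) : ℝ) * (2 * j + 1) =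
          (2 * (j + 1 + k)).choose (2 * j) * (2 * k + 2) := by exact_mod_cast h1
      have h2' : ((2 * (j + 1 + k)).choose (2 * (j + 1)) : ℝ) * (2 * j + 2) =
          (2 * (j + 1 + k)).choose (2 * j + 1) * (2 * k + 1) := by exact_mod_cast h2
      have h3' : ((j + 1 + k).choose (j + 1) : ℝ) * (j + 1) =
          (j + 1 + k).choose j * (k + 1) := by exact_mod_cast h3
      have key : ((2 * (j + 1 + k)).choose (2 * (j + 1)) : ℝ) * ((2 * j + 1) * (j + 1)) =
          (2 * (j + 1 + k)).choose (2 * j) * ((k + 1) * (2 * k + 1)) := by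
        linear_combination ((2 * j + 1) / 2 : ℝ) * h2' + ((2 * k + 1) / 2 : ℝ) * h1'
      have hpos : (0 : ℝ) < (2 * j + 1) * (j + 1) := by positivity
      refine le_of_mul_le_mul_right ?_ hpos
      rw [key, pow_succ]
      calc ((2 * (j + 1 + k)).choose (2 * j) : ℝ) * ((k + 1) * (2 * k + 1))
          ≤ ((j + 1 + k).choose j * (2 * ((j + 1 + k : ℕ) : ℝ)) ^ j) *
            ((k + 1) * (2 * k + 1)) := by gcongr
        _ = ((j + 1 + k).choose (j + 1) : ℝ) * (j + 1) * ((2 * ((j + 1 + k : ℕ) : ℝ)) ^ j *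
            (2 * k + 1)) := by rw [h3']; ring
        _ ≤ ((j + 1 + k).choose (j + 1) : ℝ) * (j + 1) * ((2 * ((j + 1 + k : ℕ) : ℝ)) ^ j *
            ((2 * ((j + 1 + k : ℕ) : ℝ)) * (2 * j + 1))) := by
            gcongr
            push_cast
            have hj : (0 : ℝ) ≤ j := by positivity
            have hk : (0 : ℝ) ≤ k := by positivity
            nlinarith [mul_nonneg hj hj, mul_nonneg hj hk]
        _ = _ := by ring

theorem sum_range_two_mul_add_one {α : Type*} [AddCommMonoid α] (F : ℕ → α) (m : ℕ) :
    ∑ k ∈ Finset.range (2 * m + 1), F k =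
      ∑ j ∈ Finset.range (m + 1), F (2 * j) + ∑ j ∈ Finset.range m, F (2 * j + 1) := by
  induction m with
  | zero => simp
  | succ m ih =>
    rw [show 2 * (m + 1) + 1 = (2 * m + 1) + 1 + 1 by ring, Finset.sum_range_succ,
      Finset.sum_range_succ, ih, Finset.sum_range_succ _ (m + 1),
      Finset.sum_range_succ (fun j => F (2 * j + 1)) m]
    rw [show 2 * (m + 1) = 2 * m + 1 + 1 by ring]
    abel

theorem add_pow_add_sub_pow (a b : ℝ) (m : ℕ) :
    (a + b) ^ (2 * m) + (a - b) ^ (2 * m) =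
      ∑ j ∈ Finset.range (m + 1), 2 * ((a ^ 2) ^ (m - j) * (b ^ 2) ^ j * (2 * m).choose (2 * j)) := by
  rw [sub_eq_add_neg, add_comm a b, add_comm a (-b), add_pow, add_pow, ← Finset.sum_add_distrib,
    sum_range_two_mul_add_one]
  have : ∑ j ∈ Finset.range m, (b ^ (2 * j + 1) * a ^ (2 * m - (2 * j + 1)) *
      ((2 * m).choose (2 * j + 1) : ℝ) + (-b) ^ (2 * j + 1) * a ^ (2 * m - (2 * j + 1)) *
      ((2 * m).choose (2 * j + 1) : ℝ)) = 0 := by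
    refine Finset.sum_eq_zero fun j _ => ?_
    rw [Odd.neg_pow ⟨j, rfl⟩]
    ring
  rw [this, add_zero]
  refine Finset.sum_congr rfl fun j _ => ?_
  rw [Even.neg_pow ⟨j, by ring⟩, show 2 * m - 2 * j = 2 * (m - j) by omega, pow_mul, pow_mul]
  ring

/-- The graph of the convex function `t ^ (2m)` lies above its tangent at `a`; after division by `a
^ (2m)` this is Bernoulli's inequality. -/
theorem pow_add_mul_le_pow_add (a d : ℝ) {m : ℕ} (hm : m ≠ 0) :
    a ^ (2 * m) + 2 * m * (a ^ (2 * m - 1) * d) ≤ (a + d) ^ (2 * m) := by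
  rcases eq_or_ne a 0 with rfl | ha
  · rw [zero_pow (by omega), zero_pow (by omega)]
    have := (even_two_mul m).pow_nonneg (0 + d)
    linarith
  · have h1 : (1 : ℝ) + (2 * m : ℕ) * (d / a) ≤ (1 + d / a) ^ (2 * m) := by
      rcases le_or_gt (-2) (d / a) with h | h
      · exact one_add_mul_le_pow h _
      · have h2 := (even_two_mul m).pow_nonneg (1 + d / a)
        have h3 : (1 : ℝ) ≤ (2 * m : ℕ) := by exact_mod_cast (by omega : 1 ≤ 2 * m)
        nlinarith
    have h2 : (a + d) ^ (2 * m) = a ^ (2 * m) * (1 + d / a) ^ (2 * m) := by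
      rw [← mul_pow]
      congr 1
      field_simp
    have h3 : a ^ (2 * m) = a ^ (2 * m - 1) * a := by
      rw [← pow_succ]
      congr 1
      omega
    have h4 : a ^ (2 * m - 1) * d = a ^ (2 * m) * (d / a) := by
      rw [h3]
      field_simp
    rw [h2, h4]
    have := mul_le_mul_of_nonneg_left h1 ((even_two_mul m).pow_nonneg a)
    push_cast at this
    linarith

/-- The sum of `(a + b) ^ (2m)` and `(a - b) ^ (2m)` contains only even powers of `b`. The tangent
inequality bounds the second power from below and produces the linear term; what remains is compared
with `(a² + 4m b²) ^ m` term by term. -/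
theorem two_point_inequality (a b : ℝ) {m : ℕ} (hm : m ≠ 0) :
    (a + b) ^ (2 * m) ≤ 2 * m * (a ^ (2 * m - 1) * b) + (a ^ 2 + 4 * m * b ^ 2) ^ m := by
  have bern : a ^ (2 * m) - 2 * m * (a ^ (2 * m - 1) * b) ≤ (a - b) ^ (2 * m) := by
    have := pow_add_mul_le_pow_add a (-b) hm
    rw [← sub_eq_add_neg] at this
    linarith
  have h1 := add_pow_add_sub_pow a b m
  have h2 : ∑ j ∈ Finset.range (m + 1),
        2 * ((a ^ 2) ^ (m - j) * (b ^ 2) ^ j * ((2 * m).choose (2 * j) : ℝ)) - a ^ (2 * m)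
      ≤ (a ^ 2 + 4 * m * b ^ 2) ^ m := by
    rw [add_comm (a ^ 2), add_pow, Finset.sum_range_succ', Finset.sum_range_succ']
    have h0 : 2 * ((a ^ 2) ^ (m - 0) * (b ^ 2) ^ 0 * ((2 * m).choose (2 * 0) : ℝ)) - a ^ (2 * m) =
        (4 * m * b ^ 2) ^ 0 * (a ^ 2) ^ (m - 0) * (m.choose 0 : ℝ) := by
      simp [← pow_mul]; ring
    rw [add_sub_assoc, h0]
    refine add_le_add (Finset.sum_le_sum fun j _ => ?_) le_rfl
    have h3 := choose_two_mul_le m (j + 1)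
    calc 2 * ((a ^ 2) ^ (m - (j + 1)) * (b ^ 2) ^ (j + 1) * ((2 * m).choose (2 * (j + 1)) : ℝ))
        = (a ^ 2) ^ (m - (j + 1)) * (b ^ 2) ^ (j + 1) *
          (2 * ((2 * m).choose (2 * (j + 1)) : ℝ)) := by ring
      _ ≤ (a ^ 2) ^ (m - (j + 1)) * (b ^ 2) ^ (j + 1) *
          (2 ^ (j + 1) * ((m.choose (j + 1) : ℝ) * (2 * m : ℝ) ^ (j + 1))) := by
          gcongr
          -- The factor `2` from adding the two expansions is absorbed into `2 ^ (j + 1)`; this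
          -- turns `2m` into the constant `4m`.
          exact le_self_pow₀ (by norm_num) (by omega)
      _ = (4 * m * b ^ 2) ^ (j + 1) * (a ^ 2) ^ (m - (j + 1)) * (m.choose (j + 1) : ℝ) := by
          rw [show (4 * m * b ^ 2 : ℝ) = 2 * (2 * m) * b ^ 2 by ring, mul_pow (2 * (2 * m : ℝ)),
            mul_pow 2 (2 * m : ℝ)]
          ring
  linarith

/-! ### Even `L^p` norms: 2-smoothness, partial integration. -/

section Lp

variable {α : Type*} [MeasurableSpace α] {μ : Measure α}

theorem lpNorm_pow_eq_integral {f : α → ℝ} (hf : AEStronglyMeasurable f μ) {k : ℕ} (hk : k ≠ 0) :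
    lpNorm f k μ ^ k = ∫ x, ‖f x‖ ^ k ∂μ := by
  rw [lpNorm_eq_integral_norm_rpow_toReal (by exact_mod_cast hk) (by simp) hf]
  simp only [ENNReal.toReal_natCast, Real.rpow_natCast]
  exact Real.rpow_inv_natCast_pow (integral_nonneg fun x => by positivity) hk

theorem memLp_natCast_iff {f : α → ℝ} (hf : AEStronglyMeasurable f μ) {k : ℕ} (hk : k ≠ 0) :
    MemLp f k μ ↔ Integrable (fun x => ‖f x‖ ^ k) μ := by
  rw [← integrable_norm_rpow_iff hf (by exact_mod_cast hk) (by simp)]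
  simp only [ENNReal.toReal_natCast, Real.rpow_natCast]

theorem lpNorm_even_pow {f : α → ℝ} (hf : AEStronglyMeasurable f μ) {m : ℕ} (hm : m ≠ 0) :
    lpNorm f (2 * m : ℕ) μ ^ (2 * m) = ∫ x, f x ^ (2 * m) ∂μ := by
  rw [lpNorm_pow_eq_integral hf (by omega)]
  simp only [Real.norm_eq_abs, (even_two_mul m).pow_abs]

theorem memLp_even_iff {f : α → ℝ} (hf : AEStronglyMeasurable f μ) {m : ℕ} (hm : m ≠ 0) :
    MemLp f (2 * m : ℕ) μ ↔ Integrable (fun x => f x ^ (2 * m)) μ := by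
  rw [memLp_natCast_iff hf (by omega)]
  simp only [Real.norm_eq_abs, (even_two_mul m).pow_abs]

theorem memLp_sq {f : α → ℝ} {m : ℕ} (hm : m ≠ 0) (hf : MemLp f (2 * m : ℕ) μ) :
    MemLp (fun x => f x ^ 2) m μ := by
  rw [memLp_natCast_iff (f := fun x => f x ^ 2) (hf.1.pow 2) hm]
  have := (memLp_even_iff hf.1 hm).1 hf
  simpa only [norm_pow, Real.norm_eq_abs, sq_abs, ← pow_mul, (even_two_mul m).pow_abs] using this

theorem lpNorm_sq {f : α → ℝ} {m : ℕ} (hm : m ≠ 0) (hf : AEStronglyMeasurable f μ) :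
    lpNorm (fun x => f x ^ 2) m μ = lpNorm f (2 * m : ℕ) μ ^ 2 := by
  refine (pow_left_inj₀ lpNorm_nonneg (by positivity) hm).1 ?_
  rw [lpNorm_pow_eq_integral (f := fun x => f x ^ 2) (hf.pow 2) hm, ← pow_mul, lpNorm_even_pow hf hm]
  simp only [norm_pow, Real.norm_eq_abs, sq_abs, ← pow_mul]

theorem integrable_pow_mul {f g : α → ℝ} {m : ℕ} (hm : m ≠ 0) (hf : MemLp f (2 * m : ℕ) μ)
    (hg : MemLp g (2 * m : ℕ) μ) : Integrable (fun x => f x ^ (2 * m - 1) * g x) μ := by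
  refine Integrable.mono' (((memLp_even_iff hf.1 hm).1 hf).add ((memLp_even_iff hg.1 hm).1 hg))
    ((hf.1.pow _).mul hg.1) (Filter.Eventually.of_forall fun x => ?_)
  have h1 : ∀ y : ℝ, y ^ (2 * m) = |y| ^ (2 * m - 1) * |y| := fun y => by
    rw [← pow_succ, show 2 * m - 1 + 1 = 2 * m by omega, (even_two_mul m).pow_abs]
  simp only [Pi.add_apply, Real.norm_eq_abs, abs_mul, abs_pow]
  rw [h1, h1]
  rcases le_total |f x| |g x| with h | h
  · have : |f x| ^ (2 * m - 1) * |g x| ≤ |g x| ^ (2 * m - 1) * |g x| := by gcongr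
    have : 0 ≤ |f x| ^ (2 * m - 1) * |f x| := by positivity
    linarith
  · have : |f x| ^ (2 * m - 1) * |g x| ≤ |f x| ^ (2 * m - 1) * |f x| := by gcongr
    have : 0 ≤ |g x| ^ (2 * m - 1) * |g x| := by positivity
    linarith

/-- Two-smoothness of `L^{2m}`: adding a function orthogonal to `f ^ (2m - 1)`. -/
theorem lpNorm_add_sq_le {f g : α → ℝ} {m : ℕ} (hm : m ≠ 0)
    (hf : MemLp f (2 * m : ℕ) μ) (hg : MemLp g (2 * m : ℕ) μ)
    (horth : ∫ x, f x ^ (2 * m - 1) * g x ∂μ = 0) :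
    lpNorm (fun x => f x + g x) (2 * m : ℕ) μ ^ 2 ≤
      lpNorm f (2 * m : ℕ) μ ^ 2 + 4 * m * lpNorm g (2 * m : ℕ) μ ^ 2 := by
  have hg2 : MemLp (fun x => (4 * m : ℝ) * g x ^ 2) m μ := (memLp_sq hm hg).const_mul _
  have hsum : MemLp (fun x => f x ^ 2 + 4 * m * g x ^ 2) m μ := (memLp_sq hm hf).add hg2
  have hmink : lpNorm (fun x => f x ^ 2 + 4 * m * g x ^ 2) m μ ≤
      lpNorm f (2 * m : ℕ) μ ^ 2 + 4 * m * lpNorm g (2 * m : ℕ) μ ^ 2 := by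
    have h1 := lpNorm_add_le (g := fun x => (4 * m : ℝ) * g x ^ 2) (memLp_sq hm hf)
      (by exact_mod_cast Nat.one_le_iff_ne_zero.2 hm)
    have h2 : lpNorm (fun x => (4 * m : ℝ) * g x ^ 2) m μ =
        4 * m * lpNorm g (2 * m : ℕ) μ ^ 2 := by
      have := lpNorm_const_smul (p := (m : ℝ≥0∞)) (4 * m : ℝ) (fun x => g x ^ 2) μ
      rw [lpNorm_sq hm hg.1] at this
      simpa [Pi.smul_def, abs_mul] using this
    rw [lpNorm_sq hm hf.1, h2] at h1
    exact h1
  -- Integrating the two-point inequality removes the linear term by orthogonality and leaves the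
  -- `L^m` norm of `f² + 4m g²`, to which Minkowski's inequality in `L^m` applies.
  refine le_trans (le_of_pow_le_pow_left₀ hm lpNorm_nonneg ?_) hmink
  have hfg : MemLp (fun x => f x + g x) (2 * m : ℕ) μ := hf.add hg
  rw [← pow_mul, lpNorm_even_pow hfg.1 hm, lpNorm_pow_eq_integral hsum.1 hm]
  have hint := (memLp_natCast_iff hsum.1 hm).1 hsum
  have h3 : ∫ x, (f x + g x) ^ (2 * m) ∂μ ≤
      ∫ x, (2 * m * (f x ^ (2 * m - 1) * g x) + ‖f x ^ 2 + 4 * m * g x ^ 2‖ ^ m) ∂μ := by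
    refine integral_mono ((memLp_even_iff hfg.1 hm).1 hfg)
      (((integrable_pow_mul hm hf hg).const_mul _).add hint) fun x => ?_
    have := two_point_inequality (f x) (g x) hm
    rwa [← Real.norm_of_nonneg (show 0 ≤ f x ^ 2 + 4 * m * g x ^ 2 by positivity)] at this
  rwa [integral_add ((integrable_pow_mul hm hf hg).const_mul _) hint, integral_const_mul, horth,
    mul_zero, zero_add] at h3

variable {β : Type*} [MeasurableSpace β] {ν : Measure β}

/-- Jensen's inequality on almost every fibre, then Fubini. -/
theorem memLp_integral_right [SFinite μ] [IsProbabilityMeasure ν] {F : α × β → ℝ} {m : ℕ} (hm : m ≠ 0)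
    (hint : Integrable F (μ.prod ν))
    (hF : MemLp F (2 * m : ℕ) (μ.prod ν)) :
    MemLp (fun x => ∫ y, F (x, y) ∂ν) (2 * m : ℕ) μ ∧
      lpNorm (fun x => ∫ y, F (x, y) ∂ν) (2 * m : ℕ) μ ≤ lpNorm F (2 * m : ℕ) (μ.prod ν) := by
  have hm2 := (memLp_even_iff hF.1 hm).1 hF
  have haes : AEStronglyMeasurable (fun x => ∫ y, F (x, y) ∂ν) μ := hF.1.integral_prod_right'
  have key : ∀ᵐ x ∂μ, (∫ y, F (x, y) ∂ν) ^ (2 * m) ≤ ∫ y, F (x, y) ^ (2 * m) ∂ν := by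
    filter_upwards [hint.prod_right_ae, hm2.prod_right_ae] with x hx1 hx2
    exact ((even_two_mul m).convexOn_pow (𝕜 := ℝ)).map_integral_le (by fun_prop) isClosed_univ
      (by simp) hx1 hx2
  have hI : Integrable (fun x => (∫ y, F (x, y) ∂ν) ^ (2 * m)) μ := by
    refine Integrable.mono' hm2.integral_prod_left (haes.pow _) ?_
    filter_upwards [key] with x hx
    rwa [Real.norm_of_nonneg ((even_two_mul m).pow_nonneg _)]
  refine ⟨(memLp_even_iff haes hm).2 hI, ?_⟩
  refine le_of_pow_le_pow_left₀ (show 2 * m ≠ 0 by omega) lpNorm_nonneg ?_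
  rw [lpNorm_even_pow haes hm, lpNorm_even_pow hF.1 hm, integral_prod _ hm2]
  exact integral_mono_ae hI hm2.integral_prod_left key

theorem lpNorm_comp_measurePreserving {f : α → β} {g : β → ℝ} {p : ℝ≥0∞}
    (hg : AEStronglyMeasurable g ν) (hf : MeasurePreserving f μ ν) :
    lpNorm (fun x => g (f x)) p μ = lpNorm g p ν := by
  have := eLpNorm_comp_measurePreserving (p := p) hg hf
  rw [← toReal_eLpNorm hg, ← toReal_eLpNorm (f := fun x => g (f x)) (hg.comp_measurePreserving hf),
    ← this]
  rfl

theorem integral_comp_measurePreserving {f : α → β} {g : β → ℝ}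
    (hg : AEStronglyMeasurable g ν) (hf : MeasurePreserving f μ ν) :
    ∫ x, g (f x) ∂μ = ∫ y, g y ∂ν := by
  rw [← hf.map_eq] at hg ⊢
  exact (integral_map hf.aemeasurable hg).symm

end Lp

/-! ### Joint laws of selected coordinates. -/

section Independence

variable {Ω S ι : Type*} [MeasurableSpace Ω] [MeasurableSpace S] {μ : Measure Ω}
  [IsProbabilityMeasure μ] {P : Measure S}

theorem measurePreserving_tuple {κ : Type*} [Fintype κ] {X : ι → Ω → S} (hX : ∀ i, Measurable (X i))
    (hind : iIndepFun X μ) (hlaw : ∀ i, μ.map (X i) = P) {e : κ → ι} (he : Function.Injective e) :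
    MeasurePreserving (fun ω (j : κ) => X (e j) ω) μ (Measure.pi fun _ => P) := by
  refine ⟨by fun_prop, ?_⟩
  rw [(iIndepFun_iff_map_fun_eq_pi_map fun j => (hX (e j)).aemeasurable).1 (hind.precomp he)]
  simp only [hlaw]

theorem measurePreserving_pi_comp [IsProbabilityMeasure P] {κ κ' : Type*} [Fintype κ] [Fintype κ']
    {e : κ → κ'} (he : Function.Injective e) :
    MeasurePreserving (fun (s : κ' → S) (j : κ) => s (e j)) (Measure.pi fun _ => P)
      (Measure.pi fun _ => P) := by
  refine measurePreserving_tuple (X := fun i (s : κ' → S) => s i) (fun i => measurable_pi_apply i)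
    ?_ (fun i => (measurePreserving_eval (fun _ : κ' => P) i).map_eq) he
  exact iIndepFun_pi (X := fun _ => id) fun i => aemeasurable_id

end Independence

/-! ### Kernels with a parameter, and their marginal and centered parts. -/

section Kernel

variable {S T : Type u} [MeasurableSpace S] [MeasurableSpace T]

/-- The product law of `n` independent variables with law `P` and a parameter with law `Q`. -/
noncomputable abbrev prodLaw (P : Measure S) (Q : Measure T) (n : ℕ) :
    Measure ((Fin n → S) × T) :=
  (Measure.pi fun _ => P).prod Q

/-- Appending the second component of the parameter to the tuple. -/
def joinLast (n : ℕ) (p : (Fin n → S) × (T × S)) : (Fin (n + 1) → S) × T :=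
  (Fin.snoc (α := fun _ => S) p.1 p.2.2, p.2.1)

/-- Moving the last entry of the tuple into the parameter. -/
def splitLast (n : ℕ) (p : (Fin (n + 1) → S) × T) : (Fin n → S) × (T × S) :=
  (fun j => p.1 j.castSucc, (p.2, p.1 (Fin.last n)))

omit [MeasurableSpace S] [MeasurableSpace T] in
@[simp]
theorem joinLast_splitLast (n : ℕ) (p : (Fin (n + 1) → S) × T) :
    joinLast n (splitLast n p) = p := by
  refine Prod.ext ?_ rfl
  exact Fin.snoc_init_self p.1

omit [MeasurableSpace S] [MeasurableSpace T] in
@[simp]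
theorem splitLast_joinLast (n : ℕ) (p : (Fin n → S) × (T × S)) :
    splitLast n (joinLast n p) = p := by
  simp [splitLast, joinLast]

theorem measurable_splitLast (n : ℕ) : Measurable (splitLast (S := S) (T := T) n) := by
  unfold splitLast
  fun_prop

theorem measurable_joinLast (n : ℕ) : Measurable (joinLast (S := S) (T := T) n) := by
  refine Measurable.prodMk (measurable_pi_iff.2 fun j => ?_) (by fun_prop)
  refine Fin.lastCases ?_ (fun j => ?_) j
  · simp only [Fin.snoc_last]
    fun_prop
  · simp only [Fin.snoc_castSucc]
    fun_prop

theorem measurePreserving_splitLast (P : Measure S) [IsProbabilityMeasure P] (Q : Measure T)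
    [IsProbabilityMeasure Q] (n : ℕ) :
    MeasurePreserving (splitLast n) (prodLaw P Q (n + 1)) (prodLaw P (Q.prod P) n) := by
  have h1 : MeasurePreserving (fun s : Fin (n + 1) → S => (s (Fin.last n), fun j : Fin n => s j.castSucc))
      (Measure.pi fun _ => P) (P.prod (Measure.pi fun _ => P)) := by
    have := measurePreserving_piFinSuccAbove (fun _ : Fin (n + 1) => P) (Fin.last n)
    convert this using 1
    ext s j
    · rfl
    · simp [MeasurableEquiv.piFinSuccAbove, Fin.init]
  have h2 := ((Measure.measurePreserving_swap (μ := P) (ν := Measure.pi fun _ : Fin n => P)).comp h1).prod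
    (MeasurePreserving.id Q)
  have h3 := measurePreserving_prodAssoc (Measure.pi fun _ : Fin n => P) P Q
  have h4 := (MeasurePreserving.id (Measure.pi fun _ : Fin n => P)).prod
    (Measure.measurePreserving_swap (μ := P) (ν := Q))
  exact h4.comp (h3.comp h2)

theorem measurePreserving_joinLast (P : Measure S) [IsProbabilityMeasure P] (Q : Measure T)
    [IsProbabilityMeasure Q] (n : ℕ) :
    MeasurePreserving (joinLast n) (prodLaw P (Q.prod P) n) (prodLaw P Q (n + 1)) := by
  refine ⟨measurable_joinLast n, ?_⟩
  rw [← (measurePreserving_splitLast P Q n).map_eq,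
    Measure.map_map (measurable_joinLast n) (measurable_splitLast n)]
  convert Measure.map_id
  ext1 p
  exact joinLast_splitLast n p

theorem measurePreserving_select (P : Measure S) [IsProbabilityMeasure P] (Q : Measure T)
    [IsProbabilityMeasure Q] {r n : ℕ} {e : Fin r → Fin n} (he : Function.Injective e) :
    MeasurePreserving (fun p : (Fin n → S) × T => ((fun j => p.1 (e j), p.2) : (Fin r → S) × T))
      (prodLaw P Q n) (prodLaw P Q r) :=
  (measurePreserving_pi_comp he).prod (MeasurePreserving.id Q)

/-- The kernel `h` with its last argument integrated out. -/
noncomputable def marginal (P : Measure S) {r : ℕ} (h : (Fin (r + 1) → S) × T → ℝ) :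
    (Fin r → S) × T → ℝ :=
  fun p => ∫ y, h (joinLast r (p.1, (p.2, y))) ∂P

/-- The kernel `h(·, y) - ∫ h(·, z) dP(z)`, with parameter `y`. -/
noncomputable def centered (P : Measure S) {r : ℕ} (h : (Fin (r + 1) → S) × T → ℝ) :
    (Fin r → S) × (T × S) → ℝ :=
  fun p => h (joinLast r p) - marginal P h (p.1, p.2.1)

/-- The U-statistic of a kernel with a parameter. -/
noncomputable def usum (r n : ℕ) (h : (Fin r → S) × T → ℝ) (p : (Fin n → S) × T) : ℝ :=
  ∑ e ∈ indexSet r n, h (fun j => p.1 (e j), p.2)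

variable (P : Measure S) [IsProbabilityMeasure P] (Q : Measure T) [IsProbabilityMeasure Q]

theorem measurable_marginal {r : ℕ} {h : (Fin (r + 1) → S) × T → ℝ} (hh : Measurable h) :
    Measurable (marginal P h) := by
  unfold marginal
  refine StronglyMeasurable.measurable (StronglyMeasurable.integral_prod_right
    (f := fun (p : (Fin r → S) × T) y => h (joinLast r (p.1, (p.2, y)))) ?_)
  refine Measurable.stronglyMeasurable ?_
  exact hh.comp ((measurable_joinLast r).comp (by fun_prop))

theorem measurable_centered {r : ℕ} {h : (Fin (r + 1) → S) × T → ℝ} (hh : Measurable h) :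
    Measurable (centered P h) :=
  (hh.comp (measurable_joinLast r)).sub ((measurable_marginal P hh).comp (by fun_prop))

theorem measurable_usum {r n : ℕ} {h : (Fin r → S) × T → ℝ} (hh : Measurable h) :
    Measurable (usum r n h) := by
  unfold usum
  exact Finset.measurable_sum _ fun e _ => hh.comp (by fun_prop)

theorem measurePreserving_assocLeft (r : ℕ) :
    MeasurePreserving (fun p : ((Fin r → S) × T) × S => (p.1.1, (p.1.2, p.2)))
      ((prodLaw P Q r).prod P) (prodLaw P (Q.prod P) r) :=
  measurePreserving_prodAssoc (Measure.pi fun _ : Fin r => P) Q P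

theorem measurePreserving_dropParam (r : ℕ) :
    MeasurePreserving (fun p : (Fin r → S) × (T × S) => (p.1, p.2.1))
      (prodLaw P (Q.prod P) r) (prodLaw P Q r) :=
  (MeasurePreserving.id (Measure.pi fun _ : Fin r => P)).prod measurePreserving_fst

section Lp

variable {P Q} {m : ℕ} {r : ℕ}

theorem memLp_marginal (hm : m ≠ 0) {h : (Fin (r + 1) → S) × T → ℝ}
    (hL : MemLp h (2 * m : ℕ) (prodLaw P Q (r + 1))) :
    MemLp (marginal P h) (2 * m : ℕ) (prodLaw P Q r) ∧
      lpNorm (marginal P h) (2 * m : ℕ) (prodLaw P Q r) ≤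
        lpNorm h (2 * m : ℕ) (prodLaw P Q (r + 1)) := by
  have hmp := (measurePreserving_joinLast P Q r).comp (measurePreserving_assocLeft P Q r)
  have hF := hL.comp_measurePreserving hmp
  have h1 := memLp_integral_right hm (hF.integrable (by exact_mod_cast (by omega : 1 ≤ 2 * m))) hF
  refine ⟨h1.1, h1.2.trans_eq ?_⟩
  exact lpNorm_comp_measurePreserving hL.1 hmp

theorem memLp_centered (hm : m ≠ 0) {h : (Fin (r + 1) → S) × T → ℝ}
    (hL : MemLp h (2 * m : ℕ) (prodLaw P Q (r + 1))) :
    MemLp (centered P h) (2 * m : ℕ) (prodLaw P (Q.prod P) r) ∧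
      lpNorm (centered P h) (2 * m : ℕ) (prodLaw P (Q.prod P) r) ≤
        2 * lpNorm h (2 * m : ℕ) (prodLaw P Q (r + 1)) := by
  have hj := measurePreserving_joinLast P Q r
  have h1 := hL.comp_measurePreserving hj
  have h2 := memLp_marginal hm hL
  have h3 := h2.1.comp_measurePreserving (measurePreserving_dropParam P Q r)
  refine ⟨h1.sub h3, ?_⟩
  have h4 := lpNorm_sub_le (g := marginal P h ∘ fun p : (Fin r → S) × (T × S) => (p.1, p.2.1)) h1
    (by exact_mod_cast (by omega : 1 ≤ 2 * m))
  have h5 : lpNorm (h ∘ joinLast r) (2 * m : ℕ) (prodLaw P (Q.prod P) r) =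
      lpNorm h (2 * m : ℕ) (prodLaw P Q (r + 1)) := lpNorm_comp_measurePreserving hL.1 hj
  have h6 : lpNorm (marginal P h ∘ fun p : (Fin r → S) × (T × S) => (p.1, p.2.1)) (2 * m : ℕ)
      (prodLaw P (Q.prod P) r) = lpNorm (marginal P h) (2 * m : ℕ) (prodLaw P Q r) :=
    lpNorm_comp_measurePreserving h2.1.1 (measurePreserving_dropParam P Q r)
  rw [h5, h6] at h4
  have : lpNorm (centered P h) (2 * m : ℕ) (prodLaw P (Q.prod P) r) = lpNorm (h ∘ joinLast r -
    marginal P h ∘ fun p : (Fin r → S) × (T × S) => (p.1, p.2.1)) (2 * m : ℕ)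
      (prodLaw P (Q.prod P) r) := rfl
  linarith [h2.2]

theorem strictMono_of_mem_indexSet {n : ℕ} {e : Fin r → Fin n} (he : e ∈ indexSet r n) :
    StrictMono e := by
  simpa [indexSet] using he

theorem memLp_usum {n : ℕ} {p : ℝ≥0∞} {h : (Fin r → S) × T → ℝ} (hL : MemLp h p (prodLaw P Q r)) :
    MemLp (usum r n h) p (prodLaw P Q n) := by
  unfold usum
  exact memLp_finsetSum _ fun e he => hL.comp_measurePreserving
    (measurePreserving_select P Q (strictMono_of_mem_indexSet he).injective)

theorem usum_congr_ae_zero {n : ℕ} {h : (Fin r → S) × T → ℝ} (hh : h =ᵐ[prodLaw P Q r] 0) :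
    usum r n h =ᵐ[prodLaw P Q n] 0 := by
  have : ∀ e ∈ indexSet r n, ∀ᵐ p ∂(prodLaw P Q n), h (fun j => p.1 (e j), p.2) = 0 := fun e he =>
    (measurePreserving_select P Q
      (strictMono_of_mem_indexSet he).injective).quasiMeasurePreserving.ae hh
  filter_upwards [(Finset.eventually_all _).2 this] with p hp
  exact Finset.sum_eq_zero hp

omit [MeasurableSpace T] in
/-- The centered kernel has mean zero in its parameter, also where `h(·, y)` is not integrable. -/
theorem integral_centered (h : (Fin (r + 1) → S) × T → ℝ) (p : (Fin r → S) × T) :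
    ∫ y, centered P h (p.1, (p.2, y)) ∂P = 0 := by
  change ∫ y, (h (joinLast r (p.1, (p.2, y))) - marginal P h p) ∂P = 0
  by_cases hi : Integrable (fun y => h (joinLast r (p.1, (p.2, y)))) P
  · rw [integral_sub hi (integrable_const _)]
    simp [marginal]
  · refine integral_undef fun hc => hi ?_
    exact (hc.add (integrable_const (marginal P h p))).congr
      (Filter.Eventually.of_forall fun y => sub_add_cancel _ _)

end Lp

end Kernel

/-! ### Splitting off the last index of a U-statistic. -/

section Recursion

variable {S T : Type u}

theorem mem_indexSet {r n : ℕ} {e : Fin r → Fin n} : e ∈ indexSet r n ↔ StrictMono e := by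
  simp [indexSet]

theorem strictMono_castSucc_comp {r n : ℕ} {e : Fin r → Fin n} (he : StrictMono e) :
    StrictMono (fun j => (e j).castSucc) :=
  fun _ _ hij => Fin.castSucc_lt_castSucc_iff.2 (he hij)

theorem strictMono_snoc_last {r n : ℕ} {e : Fin r → Fin n} (he : StrictMono e) :
    StrictMono (Fin.snoc (α := fun _ => Fin (n + 1)) (fun j => (e j).castSucc) (Fin.last n)) := by
  intro i j hij
  induction j using Fin.lastCases with
  | last =>
    obtain ⟨i, rfl⟩ := Fin.exists_castSucc_eq.2 hij.ne
    simp [Fin.castSucc_lt_last]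
  | cast j =>
    obtain ⟨i, rfl⟩ := Fin.exists_castSucc_eq.2 (hij.trans (Fin.castSucc_lt_last j)).ne
    simpa using he (Fin.castSucc_lt_castSucc_iff.1 hij)

theorem injective_snoc_last {r n : ℕ} {e : Fin r → Fin n} (he : Function.Injective e) :
    Function.Injective
      (Fin.snoc (α := fun _ => Fin (n + 1)) (fun j => (e j).castSucc) (Fin.last n)) := by
  intro i j hij
  induction i using Fin.lastCases with
  | last =>
    induction j using Fin.lastCases with
    | last => rfl
    | cast j => simp [Fin.ext_iff] at hij; have := (e j).isLt; omega
  | cast i =>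
    induction j using Fin.lastCases with
    | last => simp [Fin.ext_iff] at hij; have := (e i).isLt; omega
    | cast j => simp only [Fin.snoc_castSucc] at hij; rw [he (Fin.castSucc_injective _ hij)]

/-- An increasing tuple either avoids the top index or takes it as its last entry. -/
theorem sum_indexSet_succ {r n : ℕ} (F : (Fin (r + 1) → Fin (n + 1)) → ℝ) :
    ∑ e ∈ indexSet (r + 1) (n + 1), F e =
      ∑ e ∈ indexSet (r + 1) n, F (fun j => (e j).castSucc) +
      ∑ e ∈ indexSet r n,
        F (Fin.snoc (α := fun _ => Fin (n + 1)) (fun j => (e j).castSucc) (Fin.last n)) := by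
  classical
  rw [← Finset.sum_filter_add_sum_filter_not _
    (fun e : Fin (r + 1) → Fin (n + 1) => e (Fin.last r) ≠ Fin.last n)]
  congr 1
  · symm
    refine Finset.sum_bij (fun e _ j => (e j).castSucc) ?_ ?_ ?_ ?_
    · intro e he
      rw [Finset.mem_filter, mem_indexSet]
      exact ⟨strictMono_castSucc_comp (mem_indexSet.1 he), (Fin.castSucc_lt_last _).ne⟩
    · intro e _ e' _ hee
      funext j
      exact Fin.castSucc_injective _ (congrFun hee j)
    · intro e he
      rw [Finset.mem_filter, mem_indexSet] at he
      have hlt : ∀ j, e j ≠ Fin.last n := fun j =>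
        ((he.1.monotone (Fin.le_last j)).trans_lt (Fin.lt_last_iff_ne_last.2 he.2)).ne
      refine ⟨fun j => (e j).castPred (hlt j), mem_indexSet.2 fun i j hij => ?_, ?_⟩
      · exact he.1 hij
      · funext j
        simp
    · intro e _
      rfl
  · symm
    refine Finset.sum_bij
      (fun e _ => Fin.snoc (α := fun _ => Fin (n + 1)) (fun j => (e j).castSucc) (Fin.last n))
      ?_ ?_ ?_ ?_
    · intro e he
      rw [Finset.mem_filter, mem_indexSet]
      exact ⟨strictMono_snoc_last (mem_indexSet.1 he), by simp⟩
    · intro e _ e' _ hee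
      funext j
      have := congrFun hee j.castSucc
      simpa using this
    · intro e he
      rw [Finset.mem_filter, mem_indexSet, not_not] at he
      have hlt : ∀ j : Fin r, e j.castSucc ≠ Fin.last n := fun j => by
        rw [← he.2]
        exact (he.1 (Fin.castSucc_lt_last j)).ne
      refine ⟨fun j => (e j.castSucc).castPred (hlt j), mem_indexSet.2 fun i j hij => ?_, ?_⟩
      · exact he.1 (Fin.castSucc_lt_castSucc_iff.2 hij)
      · funext j
        induction j using Fin.lastCases with
        | last => simp [he.2]
        | cast j => simp
    · intro e _
      rfl

theorem usum_succ_joinLast {r n : ℕ} (h : (Fin (r + 1) → S) × T → ℝ)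
    (q : (Fin n → S) × (T × S)) :
    usum (r + 1) (n + 1) h (joinLast n q) =
      usum (r + 1) n h (q.1, q.2.1) + usum r n (fun p => h (joinLast r p)) q := by
  unfold usum
  rw [sum_indexSet_succ]
  congr 1
  · simp [joinLast]
  · refine Finset.sum_congr rfl fun e _ => ?_
    congr 1
    refine Prod.ext ?_ rfl
    funext j
    induction j using Fin.lastCases with
    | last => simp [joinLast]
    | cast j => simp [joinLast]

theorem usum_section_eq [MeasurableSpace S] (P : Measure S) {r n : ℕ}
    (h : (Fin (r + 1) → S) × T → ℝ) (q : (Fin n → S) × (T × S)) :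
    usum r n (fun p => h (joinLast r p)) q =
      usum r n (marginal P h) (q.1, q.2.1) + usum r n (centered P h) q := by
  unfold usum
  rw [← Finset.sum_add_distrib]
  exact Finset.sum_congr rfl fun e _ => by simp [centered]

theorem usum_zero_right {r : ℕ} (h : (Fin (r + 1) → S) × T → ℝ) (p : (Fin 0 → S) × T) :
    usum (r + 1) 0 h p = 0 :=
  Finset.sum_eq_zero fun e _ => (e 0).elim0

end Recursion

/-! ### Degeneracy and how it passes to the two parts of a kernel. -/

section Degenerate

variable {S T : Type u} [MeasurableSpace S] [MeasurableSpace T]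

/-- The kernel `h` has mean zero given any `d` of its arguments and the parameter. -/
def IsDegenerate (P : Measure S) (Q : Measure T) {r : ℕ} (d : ℕ) (h : (Fin r → S) × T → ℝ) : Prop :=
  ∀ e : Fin d → Fin r, Function.Injective e → ∀ g : (Fin d → S) × T → ℝ, Measurable g →
    (∃ C, ∀ x, |g x| ≤ C) → ∫ p, h p * g (fun j => p.1 (e j), p.2) ∂(prodLaw P Q r) = 0

variable {P : Measure S} [IsProbabilityMeasure P] {Q : Measure T} [IsProbabilityMeasure Q] {r d : ℕ}

-- With as many free arguments as the kernel has, the sign of `h` is an admissible test function,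
-- and testing against it yields the `L¹` norm.
omit [IsProbabilityMeasure P] [IsProbabilityMeasure Q] in
theorem IsDegenerate.ae_eq_zero {h : (Fin r → S) × T → ℝ} (hh : Measurable h)
    (hi : Integrable h (prodLaw P Q r)) (hd : IsDegenerate P Q r h) : h =ᵐ[prodLaw P Q r] 0 := by
  have h1 := hd id Function.injective_id (fun p => if 0 ≤ h p then 1 else -1)
    (Measurable.ite (measurableSet_le measurable_const hh) measurable_const measurable_const)
    ⟨1, fun x => by split_ifs <;> simp⟩
  have h2 : ∫ p, |h p| ∂(prodLaw P Q r) = 0 := by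
    rw [← h1]
    refine integral_congr_ae (Filter.Eventually.of_forall fun p => ?_)
    simp only [id]
    split_ifs with h0
    · simp [abs_of_nonneg h0]
    · simp [abs_of_neg (not_le.1 h0)]
  have h3 := (integral_eq_zero_iff_of_nonneg (fun p => abs_nonneg _) hi.abs).1 h2
  filter_upwards [h3] with p hp
  simpa using hp

theorem integral_marginal_mul {h : (Fin (r + 1) → S) × T → ℝ}
    (hi : Integrable h (prodLaw P Q (r + 1))) {G : (Fin r → S) × T → ℝ} (hG : Measurable G)
    (hb : ∃ C, ∀ x, |G x| ≤ C) :
    ∫ p, marginal P h p * G p ∂(prodLaw P Q r) =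
      ∫ p, h p * G (fun j => p.1 j.castSucc, p.2) ∂(prodLaw P Q (r + 1)) := by
  obtain ⟨C, hC⟩ := hb
  have hmp := (measurePreserving_joinLast P Q r).comp (measurePreserving_assocLeft P Q r)
  have hI : Integrable (fun p => h p * G (fun j => p.1 j.castSucc, p.2)) (prodLaw P Q (r + 1)) :=
    hi.mul_bdd (c := C) (hG.comp (by fun_prop)).aestronglyMeasurable
      (Filter.Eventually.of_forall fun x => hC _)
  have hI2 := (hmp.integrable_comp hI.1).2 hI
  rw [← integral_comp_measurePreserving hI.1 hmp]
  refine Eq.trans ?_ (integral_prod _ hI2).symm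
  refine integral_congr_ae (Filter.Eventually.of_forall fun p => ?_)
  simp only [marginal, ← integral_mul_const, Function.comp_apply]
  simp [joinLast]

theorem IsDegenerate.marginal {h : (Fin (r + 1) → S) × T → ℝ}
    (hi : Integrable h (prodLaw P Q (r + 1))) (hd : IsDegenerate P Q d h) :
    IsDegenerate P Q d (marginal P h) := by
  intro e he g hg ⟨C, hC⟩
  rw [integral_marginal_mul hi (G := fun p => g (fun j => p.1 (e j), p.2))
    (hg.comp (by fun_prop)) ⟨C, fun x => hC _⟩]
  exact hd (fun j => (e j).castSucc) ((Fin.castSucc_injective r).comp he) g hg ⟨C, hC⟩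

/-- The parameter `y` counts as one more argument, so testing the section with `d` arguments and `y`
is testing `h` with `d + 1` arguments. In the marginal term `y` enters only through the test
function and can be integrated out of it first. -/
theorem IsDegenerate.centered {h : (Fin (r + 1) → S) × T → ℝ}
    (hi : Integrable h (prodLaw P Q (r + 1)))
    (hi' : Integrable (UStat.marginal P h) (prodLaw P Q r)) (hd : IsDegenerate P Q (d + 1) h) :
    IsDegenerate P (Q.prod P) d (centered P h) := by
  intro e he g hg ⟨C, hC⟩
  have hsnoc := injective_snoc_last he
  have hgm : AEStronglyMeasurable (fun q : (Fin r → S) × (T × S) => g (fun j => q.1 (e j), q.2))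
      (prodLaw P (Q.prod P) r) := (hg.comp (by fun_prop)).aestronglyMeasurable
  have hj := measurePreserving_joinLast P Q r
  have hI1 : Integrable (fun q => h (joinLast r q) * g (fun j => q.1 (e j), q.2))
      (prodLaw P (Q.prod P) r) :=
    ((hj.integrable_comp hi.1).2 hi).mul_bdd (c := C) hgm (Filter.Eventually.of_forall fun x => hC _)
  have hI2 : Integrable
      (fun q => UStat.marginal P h (q.1, q.2.1) * g (fun j => q.1 (e j), q.2))
      (prodLaw P (Q.prod P) r) :=
    (((measurePreserving_dropParam P Q r).integrable_comp hi'.1).2 hi').mul_bdd (c := C) hgm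
      (Filter.Eventually.of_forall fun x => hC _)
  have hsplit : ∫ q, UStat.centered P h q * g (fun j => q.1 (e j), q.2) ∂(prodLaw P (Q.prod P) r) =
      ∫ q, h (joinLast r q) * g (fun j => q.1 (e j), q.2) ∂(prodLaw P (Q.prod P) r) -
      ∫ q, UStat.marginal P h (q.1, q.2.1) * g (fun j => q.1 (e j), q.2)
        ∂(prodLaw P (Q.prod P) r) := by
    rw [← integral_sub hI1 hI2]
    exact integral_congr_ae (Filter.Eventually.of_forall fun q => by
      simp only [UStat.centered, sub_mul])
  rw [hsplit, ← integral_comp_measurePreserving hI1.1 (measurePreserving_splitLast P Q r),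
    ← integral_comp_measurePreserving hI2.1 (measurePreserving_assocLeft P Q r)]
  have hz1 := hd _ hsnoc (fun p => g (splitLast d p)) (hg.comp (measurable_splitLast d))
    ⟨C, fun x => hC _⟩
  have hghat : Measurable fun p : (Fin d → S) × T => ∫ y, g (p.1, (p.2, y)) ∂P := by
    refine StronglyMeasurable.measurable (StronglyMeasurable.integral_prod_right
      (f := fun (p : (Fin d → S) × T) y => g (p.1, (p.2, y))) ?_)
    exact (hg.comp (by fun_prop)).stronglyMeasurable
  have hghatC : ∀ p : (Fin d → S) × T, |∫ y, g (p.1, (p.2, y)) ∂P| ≤ C := fun p => by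
    have := norm_integral_le_of_norm_le_const (μ := P) (f := fun y => g (p.1, (p.2, y))) (C := C)
      (Filter.Eventually.of_forall fun y => hC _)
    simpa using this
  -- The averaged test function is regarded as a function of `d + 1` arguments that ignores the last
  -- one.
  have hz2 := hd _ hsnoc (fun p => ∫ y, g (fun j => p.1 j.castSucc, (p.2, y)) ∂P)
    (hghat.comp (by fun_prop : Measurable fun p : (Fin (d + 1) → S) × T =>
      ((fun j : Fin d => p.1 j.castSucc, p.2) : (Fin d → S) × T)))
    ⟨C, fun x => hghatC (fun j => x.1 j.castSucc, x.2)⟩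
  have hI2' := ((measurePreserving_assocLeft P Q r).integrable_comp hI2.1).2 hI2
  have e2 : ∫ x : ((Fin r → S) × T) × S, UStat.marginal P h (x.1.1, x.1.2) *
      g (fun j => x.1.1 (e j), (x.1.2, x.2)) ∂((prodLaw P Q r).prod P) = 0 := by
    rw [← hz2]
    refine (integral_prod _ hI2').trans ?_
    have := integral_marginal_mul hi (G := fun p => ∫ y, g (fun j => p.1 (e j), (p.2, y)) ∂P)
      (hghat.comp (by fun_prop : Measurable fun p : (Fin r → S) × T =>
        ((fun j : Fin d => p.1 (e j), p.2) : (Fin d → S) × T)))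
      ⟨C, fun x => hghatC (fun j => x.1 (e j), x.2)⟩
    simp only [← integral_const_mul] at this
    simp only [Function.comp_apply]
    rw [this]
    simp [integral_const_mul]
  have e1 : ∫ x, h (joinLast r (splitLast r x)) *
      g (fun j => (splitLast r x).1 (e j), (splitLast r x).2) ∂(prodLaw P Q (r + 1)) = 0 := by
    rw [← hz1]
    simp only [joinLast_splitLast]
    simp [splitLast]
  rw [e1]
  simpa using e2

end Degenerate

/-! ### Moment bound for degenerate U-statistics. -/

theorem pow_mul_succ_sq_add_le (n q : ℕ) :
    (n : ℝ) ^ (q + 1) * ((n : ℝ) + 1) ^ 2 + (n : ℝ) ^ (q + 2) ≤ ((n : ℝ) + 1) ^ (q + 3) := by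
  have hn : (0 : ℝ) ≤ n := n.cast_nonneg
  calc (n : ℝ) ^ (q + 1) * ((n : ℝ) + 1) ^ 2 + (n : ℝ) ^ (q + 2)
      = (n : ℝ) ^ q * (n * ((n : ℝ) + 1) ^ 2 + n ^ 2) := by ring
    _ ≤ ((n : ℝ) + 1) ^ q * ((n : ℝ) + 1) ^ 3 := by
        gcongr
        · linarith
        · nlinarith [sq_nonneg (n : ℝ)]
    _ = _ := by ring

theorem pow_succ_add_pow_le (n q : ℕ) :
    (n : ℝ) ^ (q + 1) + (n : ℝ) ^ q ≤ ((n : ℝ) + 1) ^ (q + 1) := by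
  have hn : (0 : ℝ) ≤ n := n.cast_nonneg
  calc (n : ℝ) ^ (q + 1) + (n : ℝ) ^ q = (n : ℝ) ^ q * (n + 1) := by ring
    _ ≤ ((n : ℝ) + 1) ^ q * (n + 1) := by
        gcongr
        linarith
    _ = _ := by ring

theorem add_sq_le_of_sq_le {a b n c : ℝ} (ha : 0 ≤ a) (hb : 0 ≤ b) (hn : 0 ≤ n)
    (h1 : a ^ 2 ≤ n ^ 2 * c) (h2 : b ^ 2 ≤ c) : (a + b) ^ 2 ≤ (n + 1) ^ 2 * c := by
  have hc : 0 ≤ c := (sq_nonneg b).trans h2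
  have h3 : a ≤ n * √c := by
    rw [← Real.sqrt_sq hn, ← Real.sqrt_mul (sq_nonneg n)]
    exact Real.le_sqrt_of_sq_le h1
  have h4 : b ≤ √c := Real.le_sqrt_of_sq_le h2
  calc (a + b) ^ 2 ≤ (n * √c + √c) ^ 2 := by gcongr
    _ = (n + 1) ^ 2 * √c ^ 2 := by ring
    _ = (n + 1) ^ 2 * c := by rw [Real.sq_sqrt hc]

section Moments

variable {S : Type u} [MeasurableSpace S] {P : Measure S} [IsProbabilityMeasure P]
  {T : Type u} [MeasurableSpace T] {Q : Measure T} [IsProbabilityMeasure Q] {m : ℕ}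

theorem card_indexSet_le (r n : ℕ) : (indexSet r n).card ≤ n ^ r := by
  refine (Finset.card_le_univ _).trans_eq ?_
  simp

theorem lpNorm_usum_le {r n : ℕ} (hm : m ≠ 0) {h : (Fin r → S) × T → ℝ}
    (hL : MemLp h (2 * m : ℕ) (prodLaw P Q r)) :
    lpNorm (usum r n h) (2 * m : ℕ) (prodLaw P Q n) ≤
      n ^ r * lpNorm h (2 * m : ℕ) (prodLaw P Q r) := by
  have h1 := lpNorm_sum_le (s := indexSet r n)
    (f := fun e (p : (Fin n → S) × T) => h (fun j => p.1 (e j), p.2))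
    (fun e he => hL.comp_measurePreserving
      (measurePreserving_select P Q (strictMono_of_mem_indexSet he).injective))
    (show (1 : ℝ≥0∞) ≤ (2 * m : ℕ) by exact_mod_cast (by omega : 1 ≤ 2 * m))
  have h2 : lpNorm (usum r n h) (2 * m : ℕ) (prodLaw P Q n) = lpNorm (∑ e ∈ indexSet r n,
      fun (p : (Fin n → S) × T) => h (fun j => p.1 (e j), p.2)) (2 * m : ℕ) (prodLaw P Q n) := by
    congr 1
    funext p
    simp [usum]
  rw [h2]
  refine h1.trans ?_
  rw [Finset.sum_congr rfl fun e he => lpNorm_comp_measurePreserving hL.1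
    (measurePreserving_select P Q (strictMono_of_mem_indexSet he).injective), Finset.sum_const,
    nsmul_eq_mul]
  gcongr
  · exact lpNorm_nonneg
  · exact_mod_cast card_indexSet_le r n

/-- The factor built from `φ` does not involve the newest variable, in which every centered summand
has mean zero; Fubini integrates that variable first. -/
theorem integral_pow_mul_usum_centered {r n : ℕ} (hm : m ≠ 0) {h : (Fin (r + 1) → S) × T → ℝ}
    (hL : MemLp h (2 * m : ℕ) (prodLaw P Q (r + 1))) {φ : (Fin n → S) × T → ℝ}
    (hφ : MemLp φ (2 * m : ℕ) (prodLaw P Q n)) :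
    ∫ q, φ (q.1, q.2.1) ^ (2 * m - 1) * usum r n (centered P h) q ∂(prodLaw P (Q.prod P) n) = 0 := by
  have hc := (memLp_centered hm hL).1
  have hφ' := hφ.comp_measurePreserving (measurePreserving_dropParam P Q n)
  have hsel : ∀ e ∈ indexSet r n, MemLp (fun q : (Fin n → S) × (T × S) =>
      centered P h (fun j => q.1 (e j), q.2)) (2 * m : ℕ) (prodLaw P (Q.prod P) n) := fun e he =>
    hc.comp_measurePreserving
      (measurePreserving_select P (Q.prod P) (strictMono_of_mem_indexSet he).injective)
  have hI : ∀ e ∈ indexSet r n, Integrable (fun q : (Fin n → S) × (T × S) =>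
      φ (q.1, q.2.1) ^ (2 * m - 1) * centered P h (fun j => q.1 (e j), q.2))
      (prodLaw P (Q.prod P) n) := fun e he => integrable_pow_mul hm hφ' (hsel e he)
  simp only [usum, Finset.mul_sum]
  rw [integral_finsetSum _ hI]
  refine Finset.sum_eq_zero fun e he => ?_
  rw [← integral_comp_measurePreserving (hI e he).1 (measurePreserving_assocLeft P Q n)]
  refine (integral_prod _ (((measurePreserving_assocLeft P Q n).integrable_comp (hI e he).1).2
    (hI e he))).trans ?_
  simp only [Function.comp_apply, integral_const_mul]
  refine integral_eq_zero_of_ae (Filter.Eventually.of_forall fun p => ?_)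
  have := integral_centered (P := P) h ((fun j => p.1 (e j)), p.2)
  simp only at this
  simp [this]

/-- The parameter space is quantified inside the induction because the centered kernel lives over `T
× S`. The index `i` is the order of degeneracy plus one, and `i = 0` means no degeneracy. -/
theorem lpNorm_usum_sq_le (hm : m ≠ 0) (n : ℕ) :
    ∀ (T : Type u) [MeasurableSpace T] (Q : Measure T) [IsProbabilityMeasure Q] (r i : ℕ)
      (h : (Fin r → S) × T → ℝ), Measurable h → MemLp h (2 * m : ℕ) (prodLaw P Q r) → i ≤ r →
      (∀ d, i = d + 1 → IsDegenerate P Q d h) →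
      lpNorm (usum r n h) (2 * m : ℕ) (prodLaw P Q n) ^ 2 ≤
        (16 * m) ^ i * n ^ (2 * r - i) * lpNorm h (2 * m : ℕ) (prodLaw P Q r) ^ 2 := by
  induction n with
  | zero =>
    intro T _ Q _ r i h _ hL hir _
    rcases r with _ | r
    -- For `r = 0` the empty tuple contributes one term, so the sum does not vanish even at `n = 0`;
    -- the bound holds because `0 ^ 0 = 1`.
    · obtain rfl : i = 0 := by omega
      have := lpNorm_usum_le (n := 0) hm hL
      simp only [pow_zero, one_mul] at this ⊢
      have h0 : (0 : ℝ) ≤ lpNorm (usum 0 0 h) (2 * m : ℕ) (prodLaw P Q 0) := lpNorm_nonneg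
      simp only [Nat.mul_zero, Nat.sub_self, pow_zero, one_mul]
      gcongr
    · rw [show usum (r + 1) 0 h = fun _ => 0 from funext fun p => usum_zero_right h p,
        lpNorm_fun_zero, zero_pow two_ne_zero]
      positivity
  | succ n ih =>
    intro T _ Q _ r i h hmeas hL hir hdeg
    rcases i with _ | d
    · have := lpNorm_usum_le (n := n + 1) hm hL
      have h0 : (0 : ℝ) ≤ lpNorm (usum r (n + 1) h) (2 * m : ℕ) (prodLaw P Q (n + 1)) :=
        lpNorm_nonneg
      calc _ ≤ _ := pow_le_pow_left₀ h0 this 2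
        _ = _ := by
          rw [Nat.sub_zero]
          ring
    · obtain ⟨r, rfl⟩ : ∃ k, r = k + 1 := ⟨r - 1, by omega⟩
      have hd := hdeg d rfl
      have hone : (1 : ℝ≥0∞) ≤ (2 * m : ℕ) := by exact_mod_cast (by omega : 1 ≤ 2 * m)
      have hint : Integrable h (prodLaw P Q (r + 1)) := hL.integrable hone
      obtain ⟨hLm, hNm⟩ := memLp_marginal hm hL
      obtain ⟨hLc, hNc⟩ := memLp_centered hm hL
      have hdrop := measurePreserving_dropParam P Q n
      have hA1 : MemLp (usum (r + 1) n h) (2 * m : ℕ) (prodLaw P Q n) := memLp_usum hL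
      have hA2 : MemLp (usum r n (marginal P h)) (2 * m : ℕ) (prodLaw P Q n) := memLp_usum hLm
      set φ : (Fin n → S) × T → ℝ := fun p => usum (r + 1) n h p + usum r n (marginal P h) p
        with hφdef
      have hφ : MemLp φ (2 * m : ℕ) (prodLaw P Q n) := hA1.add hA2
      have hB : MemLp (usum r n (centered P h)) (2 * m : ℕ) (prodLaw P (Q.prod P) n) :=
        memLp_usum hLc
      have hstep := lpNorm_add_sq_le hm (hφ.comp_measurePreserving hdrop) hB
        (integral_pow_mul_usum_centered hm hL hφ)
      have e1 : lpNorm (usum (r + 1) (n + 1) h) (2 * m : ℕ) (prodLaw P Q (n + 1)) =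
          lpNorm (fun q => (φ ∘ fun q : (Fin n → S) × (T × S) => (q.1, q.2.1)) q +
            usum r n (centered P h) q) (2 * m : ℕ) (prodLaw P (Q.prod P) n) := by
        rw [← lpNorm_comp_measurePreserving (memLp_usum hL).1 (measurePreserving_joinLast P Q n)]
        congr 1
        funext q
        rw [usum_succ_joinLast, usum_section_eq P, ← add_assoc]
        rfl
      have e2 : lpNorm (φ ∘ fun q : (Fin n → S) × (T × S) => (q.1, q.2.1)) (2 * m : ℕ)
          (prodLaw P (Q.prod P) n) = lpNorm φ (2 * m : ℕ) (prodLaw P Q n) :=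
        lpNorm_comp_measurePreserving hφ.1 hdrop
      rw [← e1, e2] at hstep
      have hφle : lpNorm φ (2 * m : ℕ) (prodLaw P Q n) ≤
          lpNorm (usum (r + 1) n h) (2 * m : ℕ) (prodLaw P Q n) +
          lpNorm (usum r n (marginal P h)) (2 * m : ℕ) (prodLaw P Q n) := lpNorm_add_le hA1 hone
      have ihB := ih (T × S) (Q.prod P) r d (centered P h) (measurable_centered P hmeas) hLc
        (by omega) (fun d' hd' => by
          subst hd'
          exact hd.centered hint (hLm.integrable hone))
      have ihA := ih T Q (r + 1) (d + 1) h hmeas hL hir hdeg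
      set H := lpNorm h (2 * m : ℕ) (prodLaw P Q (r + 1)) with hH
      have hH0 : 0 ≤ H := lpNorm_nonneg
      have hc0 : 0 ≤ lpNorm (centered P h) (2 * m : ℕ) (prodLaw P (Q.prod P) r) := lpNorm_nonneg
      have hm0 : 0 ≤ lpNorm (marginal P h) (2 * m : ℕ) (prodLaw P Q r) := lpNorm_nonneg
      have hφ0 : 0 ≤ lpNorm φ (2 * m : ℕ) (prodLaw P Q n) := lpNorm_nonneg
      have ha0 : 0 ≤ lpNorm (usum (r + 1) n h) (2 * m : ℕ) (prodLaw P Q n) := lpNorm_nonneg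
      have hb0 : 0 ≤ lpNorm (usum r n (marginal P h)) (2 * m : ℕ) (prodLaw P Q n) := lpNorm_nonneg
      -- The constant `16m` is the smoothness constant `4m` times the square of the factor `2` lost
      -- in centering.
      have hBle : 4 * m * lpNorm (usum r n (centered P h)) (2 * m : ℕ)
          (prodLaw P (Q.prod P) n) ^ 2 ≤ (16 * m) ^ (d + 1) * n ^ (2 * r - d) * H ^ 2 := by
        calc _ ≤ 4 * m * ((16 * m) ^ d * n ^ (2 * r - d) *
              lpNorm (centered P h) (2 * m : ℕ) (prodLaw P (Q.prod P) r) ^ 2) := by gcongr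
          _ ≤ 4 * m * ((16 * m) ^ d * n ^ (2 * r - d) * (2 * H) ^ 2) := by gcongr
          _ = _ := by ring
      set K : ℝ := (16 * m) ^ (d + 1) * H ^ 2 with hK
      have hK0 : 0 ≤ K := by positivity
      rcases Nat.lt_or_ge d r with hdr | hdr
      · have ihM := ih T Q r (d + 1) (marginal P h) (measurable_marginal P hmeas) hLm (by omega)
          (fun d' hd' => by
            obtain rfl : d' = d := by omega
            exact hd.marginal hint)
        obtain ⟨q, hq⟩ : ∃ q, 2 * r - (d + 1) = q + 1 := ⟨2 * r - (d + 1) - 1, by omega⟩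
        rw [hq] at ihM
        rw [show 2 * (r + 1) - (d + 1) = q + 3 by omega] at ihA ⊢
        rw [show 2 * r - d = q + 2 by omega] at hBle
        have h1 : lpNorm (usum (r + 1) n h) (2 * m : ℕ) (prodLaw P Q n) ^ 2 ≤
            (n : ℝ) ^ 2 * (n ^ (q + 1) * K) := ihA.trans_eq (by rw [hK]; ring)
        have h2 : lpNorm (usum r n (marginal P h)) (2 * m : ℕ) (prodLaw P Q n) ^ 2 ≤
            (n : ℝ) ^ (q + 1) * K := by
          calc _ ≤ (16 * m : ℝ) ^ (d + 1) * n ^ (q + 1) * H ^ 2 := ihM.trans (by gcongr)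
            _ = _ := by rw [hK]; ring
        have h3 := add_sq_le_of_sq_le ha0 hb0 n.cast_nonneg h1 h2
        calc _ ≤ _ := hstep
          _ ≤ (n + 1) ^ 2 * (n ^ (q + 1) * K) + (16 * m) ^ (d + 1) * n ^ (q + 2) * H ^ 2 :=
              add_le_add ((pow_le_pow_left₀ hφ0 hφle 2).trans h3) hBle
          _ = ((n : ℝ) ^ (q + 1) * ((n : ℝ) + 1) ^ 2 + (n : ℝ) ^ (q + 2)) * K := by rw [hK]; ring
          _ ≤ ((n : ℝ) + 1) ^ (q + 3) * K := by
              gcongr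
              exact pow_mul_succ_sq_add_le n q
          _ = _ := by rw [hK]; push_cast; ring
      -- Here `h` is degenerate of the maximal order, so its marginal, degenerate in all of its `r`
      -- arguments, vanishes almost everywhere and only the martingale increment remains.
      · obtain rfl : d = r := by omega
        have hz := usum_congr_ae_zero (n := n)
          ((hd.marginal hint).ae_eq_zero (measurable_marginal P hmeas) (hLm.integrable hone))
        rw [(lpNorm_eq_zero hA2 (by exact_mod_cast (by omega : 2 * m ≠ 0))).2 hz, add_zero] at hφle
        rw [show 2 * (d + 1) - (d + 1) = d + 1 by omega] at ihA ⊢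
        rw [show 2 * d - d = d by omega] at hBle
        calc _ ≤ _ := hstep
          _ ≤ (16 * m) ^ (d + 1) * n ^ (d + 1) * H ^ 2 + (16 * m) ^ (d + 1) * n ^ d * H ^ 2 :=
              add_le_add ((pow_le_pow_left₀ hφ0 hφle 2).trans ihA) hBle
          _ = ((n : ℝ) ^ (d + 1) + (n : ℝ) ^ d) * K := by rw [hK]; ring
          _ ≤ ((n : ℝ) + 1) ^ (d + 1) * K := by
              gcongr
              exact pow_succ_add_pow_le n d
          _ = _ := by rw [hK]; push_cast; ring

end Moments

/-! ### Martingale plus drift, and the maximal inequality. -/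

section Maximal

variable {S : Type u} [MeasurableSpace S] {P : Measure S} [IsProbabilityMeasure P]
  {T : Type u} [MeasurableSpace T] {Q : Measure T} [IsProbabilityMeasure Q] {m r d : ℕ}

/-- The martingale part of the U-statistic. -/
noncomputable def martPart (P : Measure S) (h : (Fin (r + 1) → S) × T → ℝ) :
    (n : ℕ) → (Fin n → S) × T → ℝ
  | 0 => fun _ => 0
  | n + 1 => fun p => martPart P h n (fun j => p.1 j.castSucc, p.2) +
      usum r n (centered P h) (splitLast n p)

theorem measurable_martPart {h : (Fin (r + 1) → S) × T → ℝ} (hh : Measurable h) (n : ℕ) :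
    Measurable (martPart P h n) := by
  induction n with
  | zero => exact measurable_const
  | succ n ih =>
    exact (ih.comp (by fun_prop)).add
      ((measurable_usum (measurable_centered P hh)).comp (measurable_splitLast n))

omit [IsProbabilityMeasure P] [MeasurableSpace T] in
theorem martPart_succ_joinLast (h : (Fin (r + 1) → S) × T → ℝ) (n : ℕ)
    (q : (Fin n → S) × (T × S)) :
    martPart P h (n + 1) (joinLast n q) =
      martPart P h n (q.1, q.2.1) + usum r n (centered P h) q := by
  simp only [martPart, splitLast_joinLast]
  simp [joinLast]

theorem memLp_martPart (hm : m ≠ 0) {h : (Fin (r + 1) → S) × T → ℝ}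
    (hL : MemLp h (2 * m : ℕ) (prodLaw P Q (r + 1))) (n : ℕ) :
    MemLp (martPart P h n) (2 * m : ℕ) (prodLaw P Q n) := by
  induction n with
  | zero => exact MemLp.zero
  | succ n ih =>
    have hs := measurePreserving_splitLast P Q n
    exact (ih.comp_measurePreserving ((measurePreserving_dropParam P Q n).comp hs)).add
      ((memLp_usum (memLp_centered hm hL).1).comp_measurePreserving hs)

/-- The increments are U-statistics of the centered kernel, so their squared norms grow like `n ^
(2r - d)`; summing these by 2-smoothness adds one power of `n`. -/
theorem lpNorm_martPart_sq_le (hm : m ≠ 0) {h : (Fin (r + 1) → S) × T → ℝ} (hh : Measurable h)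
    (hL : MemLp h (2 * m : ℕ) (prodLaw P Q (r + 1))) (hdr : d ≤ r)
    (hd : IsDegenerate P Q d h) (n : ℕ) :
    lpNorm (martPart P h n) (2 * m : ℕ) (prodLaw P Q n) ^ 2 ≤
      (16 * m) ^ (d + 1) * n ^ (2 * r - d + 1) *
        lpNorm h (2 * m : ℕ) (prodLaw P Q (r + 1)) ^ 2 := by
  induction n with
  | zero =>
    rw [show martPart P h 0 = fun _ => 0 from rfl, lpNorm_fun_zero, zero_pow two_ne_zero]
    positivity
  | succ n ih =>
    have hone : (1 : ℝ≥0∞) ≤ (2 * m : ℕ) := by exact_mod_cast (by omega : 1 ≤ 2 * m)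
    obtain ⟨hLm, hNm⟩ := memLp_marginal hm hL
    obtain ⟨hLc, hNc⟩ := memLp_centered hm hL
    have hdrop := measurePreserving_dropParam P Q n
    have hφ := memLp_martPart hm hL n
    have hstep := lpNorm_add_sq_le hm (hφ.comp_measurePreserving hdrop) (memLp_usum hLc)
      (integral_pow_mul_usum_centered hm hL hφ)
    have e1 : lpNorm (martPart P h (n + 1)) (2 * m : ℕ) (prodLaw P Q (n + 1)) =
        lpNorm (fun q => (martPart P h n ∘ fun q : (Fin n → S) × (T × S) => (q.1, q.2.1)) q +
          usum r n (centered P h) q) (2 * m : ℕ) (prodLaw P (Q.prod P) n) := by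
      rw [← lpNorm_comp_measurePreserving (memLp_martPart hm hL (n + 1)).1
        (measurePreserving_joinLast P Q n)]
      congr 1
      funext q
      exact martPart_succ_joinLast h n q
    have e2 : lpNorm (martPart P h n ∘ fun q : (Fin n → S) × (T × S) => (q.1, q.2.1)) (2 * m : ℕ)
        (prodLaw P (Q.prod P) n) = lpNorm (martPart P h n) (2 * m : ℕ) (prodLaw P Q n) :=
      lpNorm_comp_measurePreserving hφ.1 hdrop
    rw [← e1, e2] at hstep
    have hB := lpNorm_usum_sq_le hm n (T × S) (Q.prod P) r d (centered P h)
      (measurable_centered P hh) hLc hdr (fun d' hd' => by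
        subst hd'
        exact hd.centered (hL.integrable hone) (hLm.integrable hone))
    set H := lpNorm h (2 * m : ℕ) (prodLaw P Q (r + 1)) with hH
    have hc0 : 0 ≤ lpNorm (centered P h) (2 * m : ℕ) (prodLaw P (Q.prod P) r) := lpNorm_nonneg
    calc _ ≤ _ := hstep
      _ ≤ (16 * m) ^ (d + 1) * n ^ (2 * r - d + 1) * H ^ 2 +
          4 * m * ((16 * m) ^ d * n ^ (2 * r - d) * (2 * H) ^ 2) := by
          refine add_le_add ih ?_
          refine mul_le_mul_of_nonneg_left (hB.trans ?_) (by positivity)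
          gcongr
      _ = (16 * m) ^ (d + 1) * H ^ 2 * ((n : ℝ) ^ (2 * r - d + 1) + (n : ℝ) ^ (2 * r - d)) := by
          ring
      _ ≤ (16 * m) ^ (d + 1) * H ^ 2 * ((n : ℝ) + 1) ^ (2 * r - d + 1) := by
          gcongr
          exact pow_succ_add_pow_le n _
      _ = _ := by push_cast; ring

variable {Ω : Type v} [MeasurableSpace Ω] {μ : Measure Ω} [IsProbabilityMeasure μ]
  {X : ℕ → Ω → S} {τ : Ω → T}

/-- The first `n` variables, together with the parameter. -/
def initial (X : ℕ → Ω → S) (τ : Ω → T) (n : ℕ) (ω : Ω) : (Fin n → S) × T :=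
  (fun j => X j ω, τ ω)

omit [MeasurableSpace S] [MeasurableSpace T] [MeasurableSpace Ω] in
theorem fst_splitLast_initial (n : ℕ) (ω : Ω) :
    ((splitLast n (initial X τ (n + 1) ω)).1, (splitLast n (initial X τ (n + 1) ω)).2.1) =
      initial X τ n ω := rfl

/-- The filtration generated by the variables and the parameter. -/
def initialFiltration (hX : ∀ n, Measurable (initial X τ n)) :
    Filtration ℕ (inferInstance : MeasurableSpace Ω) where
  seq n := MeasurableSpace.comap (initial X τ n) inferInstance
  mono' := by
    refine monotone_nat_of_le_succ fun n => ?_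
    rw [show initial X τ n = (fun p : (Fin (n + 1) → S) × T =>
      ((fun j : Fin n => p.1 j.castSucc, p.2) : (Fin n → S) × T)) ∘ initial X τ (n + 1) from rfl,
      ← MeasurableSpace.comap_comp]
    exact MeasurableSpace.comap_mono (Measurable.comap_le (by fun_prop))
  le' n := (hX n).comap_le

-- This is the Doob decomposition: the drift added at step `k + 1` is the U-statistic of the
-- marginal kernel on the first `k` variables.
omit [IsProbabilityMeasure P] [MeasurableSpace T] [MeasurableSpace Ω] in
theorem usum_initial_eq (h : (Fin (r + 1) → S) × T → ℝ) (n : ℕ) (ω : Ω) :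
    usum (r + 1) n h (initial X τ n ω) = martPart P h n (initial X τ n ω) +
      ∑ k ∈ Finset.range n, usum r k (marginal P h) (initial X τ k ω) := by
  induction n with
  | zero => simp [usum_zero_right, martPart]
  | succ n ih =>
    have := usum_succ_joinLast h (splitLast n (initial X τ (n + 1) ω))
    rw [joinLast_splitLast, usum_section_eq P, fst_splitLast_initial, ih] at this
    rw [this, Finset.sum_range_succ, martPart]
    change _ = martPart P h n (initial X τ n ω) + _ + _
    ring

/-- By the tangent inequality the next power exceeds the current one by at least a term linear in
the increment, and that term integrates to zero over every event of the past. -/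
theorem submartingale_martPart_pow (hm : m ≠ 0) {h : (Fin (r + 1) → S) × T → ℝ}
    (hh : Measurable h) (hL : MemLp h (2 * m : ℕ) (prodLaw P Q (r + 1)))
    (hlaw : ∀ n, MeasurePreserving (initial X τ n) μ (prodLaw P Q n)) :
    Submartingale (fun n ω => martPart P h n (initial X τ n ω) ^ (2 * m))
      (initialFiltration fun n => (hlaw n).measurable) μ := by
  have hM := fun n => (memLp_martPart hm hL n).comp_measurePreserving (hlaw n)
  have hMi : ∀ n, Integrable (fun ω => martPart P h n (initial X τ n ω) ^ (2 * m)) μ :=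
    fun n => (memLp_even_iff (hM n).1 hm).1 (hM n)
  refine submartingale_of_setIntegral_le_succ (fun n => ?_) hMi fun n s hs => ?_
  · refine Measurable.stronglyMeasurable ?_
    exact ((measurable_martPart hh n).comp (comap_measurable _)).pow_const _
  · obtain ⟨B, hB, rfl⟩ := hs
    have hsplit := (measurePreserving_splitLast P Q n).comp (hlaw (n + 1))
    -- An event of the past has the form `initial X τ n ⁻¹' B`. Putting its indicator inside `φ`
    -- reduces the integral over it to the orthogonality lemma, as `2m - 1 ≠ 0`.
    have hφ : MemLp (B.indicator (martPart P h n)) (2 * m : ℕ) (prodLaw P Q n) :=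
      (memLp_martPart hm hL n).indicator hB
    have hU : MemLp (usum r n (centered P h)) (2 * m : ℕ) (prodLaw P (Q.prod P) n) :=
      memLp_usum (memLp_centered hm hL).1
    have horth := integral_pow_mul_usum_centered hm hL hφ
    have hprod : Integrable (fun q : (Fin n → S) × (T × S) =>
        B.indicator (martPart P h n) (q.1, q.2.1) ^ (2 * m - 1) * usum r n (centered P h) q)
        (prodLaw P (Q.prod P) n) :=
      integrable_pow_mul hm (hφ.comp_measurePreserving (measurePreserving_dropParam P Q n)) hU
    rw [← integral_comp_measurePreserving hprod.1 hsplit] at horth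
    have hD := hU.comp_measurePreserving hsplit
    have hMD : Integrable (fun ω => martPart P h n (initial X τ n ω) ^ (2 * m - 1) *
        usum r n (centered P h) (splitLast n (initial X τ (n + 1) ω))) μ :=
      integrable_pow_mul hm (hM n) hD
    have hsm : MeasurableSet (initial X τ n ⁻¹' B) := (hlaw n).measurable hB
    have hz : ∫ ω in initial X τ n ⁻¹' B, martPart P h n (initial X τ n ω) ^ (2 * m - 1) *
        usum r n (centered P h) (splitLast n (initial X τ (n + 1) ω)) ∂μ = 0 := by
      rw [← horth, ← integral_indicator hsm]
      refine integral_congr_ae (Filter.Eventually.of_forall fun ω => ?_)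
      simp only [Function.comp_apply, fst_splitLast_initial]
      by_cases hω : initial X τ n ω ∈ B
      · rw [Set.indicator_of_mem (show ω ∈ initial X τ n ⁻¹' B from hω), Set.indicator_of_mem hω]
      · rw [Set.indicator_of_notMem (show ω ∉ initial X τ n ⁻¹' B from hω), Set.indicator_of_notMem hω,
          zero_pow (by omega), zero_mul]
    calc ∫ ω in initial X τ n ⁻¹' B, martPart P h n (initial X τ n ω) ^ (2 * m) ∂μ
        = ∫ ω in initial X τ n ⁻¹' B, (martPart P h n (initial X τ n ω) ^ (2 * m) +
          2 * m * (martPart P h n (initial X τ n ω) ^ (2 * m - 1) *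
            usum r n (centered P h) (splitLast n (initial X τ (n + 1) ω)))) ∂μ := by
          rw [integral_add (hMi n).integrableOn (hMD.const_mul _).integrableOn,
            integral_const_mul, hz, mul_zero, add_zero]
      _ ≤ _ := by
          refine integral_mono ((hMi n).integrableOn.add (hMD.const_mul _).integrableOn)
            (hMi (n + 1)).integrableOn fun ω => ?_
          exact pow_add_mul_le_pow_add _ _ hm

omit [IsProbabilityMeasure μ] in
theorem measureReal_le_of_lpNorm_sq_le {f : Ω → ℝ} (hm : m ≠ 0) (hf : MemLp f (2 * m : ℕ) μ)
    {l b : ℝ} (hl : 0 < l) (hb : lpNorm f (2 * m : ℕ) μ ^ 2 ≤ b) :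
    μ.real {ω | l ≤ |f ω|} ≤ (b / l ^ 2) ^ m := by
  have h1 := mul_meas_ge_le_integral_of_nonneg
    (Filter.Eventually.of_forall fun ω => (even_two_mul m).pow_nonneg (f ω))
    ((memLp_even_iff hf.1 hm).1 hf) (l ^ (2 * m))
  rw [← lpNorm_even_pow hf.1 hm] at h1
  have h2 : {ω | l ≤ |f ω|} = {ω | l ^ (2 * m) ≤ f ω ^ (2 * m)} := by
    ext ω
    rw [Set.mem_ofPred_eq, Set.mem_ofPred_eq, ← (even_two_mul m).pow_abs (f ω),
      pow_le_pow_iff_left₀ hl.le (abs_nonneg _) (by omega)]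
  rw [h2, div_pow, ← pow_mul, le_div_iff₀' (by positivity)]
  refine h1.trans ?_
  rw [pow_mul]
  gcongr

theorem measureReal_max_martPart_le (hm : m ≠ 0) {h : (Fin (r + 1) → S) × T → ℝ}
    (hh : Measurable h) (hL : MemLp h (2 * m : ℕ) (prodLaw P Q (r + 1)))
    (hlaw : ∀ n, MeasurePreserving (initial X τ n) μ (prodLaw P Q n)) {l b : ℝ} (hl : 0 < l) (N : ℕ)
    (hb : lpNorm (martPart P h N) (2 * m : ℕ) (prodLaw P Q N) ^ 2 ≤ b) :
    μ.real {ω | ∃ n ≤ N, l ≤ |martPart P h n (initial X τ n ω)|} ≤ (b / l ^ 2) ^ m := by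
  have hsub := submartingale_martPart_pow hm hh hL hlaw
  have hM := (memLp_martPart hm hL N).comp_measurePreserving (hlaw N)
  have hmax := maximal_ineq hsub (fun n ω => (even_two_mul m).pow_nonneg _)
    (ε := ⟨l ^ (2 * m), by positivity⟩) N
  have hset : {ω | ∃ n ≤ N, l ≤ |martPart P h n (initial X τ n ω)|} =
      {ω | l ^ (2 * m) ≤ (Finset.range (N + 1)).sup' Finset.nonempty_range_add_one
        fun k => martPart P h k (initial X τ k ω) ^ (2 * m)} := by
    ext ω
    simp only [Set.mem_ofPred_eq, Finset.le_sup'_iff, Finset.mem_range, Nat.lt_succ_iff]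
    refine exists_congr fun n => and_congr_right fun _ => ?_
    rw [← (even_two_mul m).pow_abs (martPart P h n _),
      pow_le_pow_iff_left₀ hl.le (abs_nonneg _) (by omega)]
  have hnn : 0 ≤ᵐ[μ] fun ω => martPart P h N (initial X τ N ω) ^ (2 * m) :=
    Filter.Eventually.of_forall fun ω => (even_two_mul m).pow_nonneg _
  have h1 : l ^ (2 * m) * μ.real {ω | ∃ n ≤ N, l ≤ |martPart P h n (initial X τ n ω)|} ≤
      ∫ ω, martPart P h N (initial X τ N ω) ^ (2 * m) ∂μ := by
    rw [hset]
    have h2 := hmax.trans (ENNReal.ofReal_le_ofReal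
      (setIntegral_le_integral ((memLp_even_iff hM.1 hm).1 hM) hnn))
    have h3 := ENNReal.toReal_mono ENNReal.ofReal_ne_top h2
    rw [ENNReal.toReal_ofReal (integral_nonneg_of_ae hnn), ENNReal.toReal_mul] at h3
    exact h3
  have h4 : ∫ ω, martPart P h N (initial X τ N ω) ^ (2 * m) ∂μ =
      lpNorm (martPart P h N) (2 * m : ℕ) (prodLaw P Q N) ^ (2 * m) := by
    rw [← lpNorm_comp_measurePreserving (memLp_martPart hm hL N).1 (hlaw N)]
    exact (lpNorm_even_pow hM.1 hm).symm
  rw [div_pow, ← pow_mul, le_div_iff₀' (by positivity)]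
  refine h1.trans ?_
  rw [h4, pow_mul]
  gcongr

-- This sum of absolute values dominates the drift at all times up to `N`. Its `N` terms have norms
-- of order `N ^ ((2r - d - 1) / 2)`, so the squared norm has order `N ^ (2r - d + 1)`, as for the
-- martingale part.
omit [IsProbabilityMeasure μ] in
theorem lpNorm_sum_marginal_sq_le (hm : m ≠ 0) {h : (Fin (r + 1) → S) × T → ℝ}
    (hh : Measurable h) (hL : MemLp h (2 * m : ℕ) (prodLaw P Q (r + 1))) (hdr : d ≤ r)
    (hd : IsDegenerate P Q d h)
    (hlaw : ∀ n, MeasurePreserving (initial X τ n) μ (prodLaw P Q n)) (N : ℕ) :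
    MemLp (fun ω => ∑ k ∈ Finset.range N, |usum r k (marginal P h) (initial X τ k ω)|)
      (2 * m : ℕ) μ ∧
    lpNorm (fun ω => ∑ k ∈ Finset.range N, |usum r k (marginal P h) (initial X τ k ω)|)
      (2 * m : ℕ) μ ^ 2 ≤ (16 * m) ^ (d + 1) * N ^ (2 * r - d + 1) *
        lpNorm h (2 * m : ℕ) (prodLaw P Q (r + 1)) ^ 2 := by
  have hone : (1 : ℝ≥0∞) ≤ (2 * m : ℕ) := by exact_mod_cast (by omega : 1 ≤ 2 * m)
  obtain ⟨hLm, hNm⟩ := memLp_marginal hm hL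
  have hint : Integrable h (prodLaw P Q (r + 1)) := hL.integrable hone
  have hU : ∀ k, MemLp (usum r k (marginal P h)) (2 * m : ℕ) (prodLaw P Q k) :=
    fun k => memLp_usum hLm
  have hk : ∀ k, MemLp (fun ω => usum r k (marginal P h) (initial X τ k ω)) (2 * m : ℕ) μ :=
    fun k => (hU k).comp_measurePreserving (hlaw k)
  have hfun : (fun ω => ∑ k ∈ Finset.range N, |usum r k (marginal P h) (initial X τ k ω)|) =
      ∑ k ∈ Finset.range N, fun ω => |usum r k (marginal P h) (initial X τ k ω)| := by
    funext ω
    simp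
  refine ⟨memLp_finsetSum _ fun k _ => (hk k).abs, ?_⟩
  have hsum := lpNorm_sum_le (s := Finset.range N)
    (f := fun k ω => |usum r k (marginal P h) (initial X τ k ω)|) (fun k _ => (hk k).abs) hone
  rw [← hfun] at hsum
  have hnorm : ∀ k, lpNorm (fun ω => |usum r k (marginal P h) (initial X τ k ω)|) (2 * m : ℕ) μ =
      lpNorm (usum r k (marginal P h)) (2 * m : ℕ) (prodLaw P Q k) := fun k => by
    rw [lpNorm_fun_abs (hk k).1]
    exact lpNorm_comp_measurePreserving (hU k).1 (hlaw k)
  simp only [hnorm] at hsum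
  set H := lpNorm h (2 * m : ℕ) (prodLaw P Q (r + 1)) with hH
  have hm0 : 0 ≤ lpNorm (marginal P h) (2 * m : ℕ) (prodLaw P Q r) := lpNorm_nonneg
  refine (pow_le_pow_left₀ lpNorm_nonneg hsum 2).trans ?_
  rcases hdr.lt_or_eq with hlt | rfl
  · have hkb : ∀ k ∈ Finset.range N, lpNorm (usum r k (marginal P h)) (2 * m : ℕ) (prodLaw P Q k) ≤
        √((16 * m) ^ (d + 1) * N ^ (2 * r - (d + 1)) * H ^ 2) := fun k hk => by
      refine Real.le_sqrt_of_sq_le ((lpNorm_usum_sq_le hm k T Q r (d + 1) _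
        (measurable_marginal P hh) hLm hlt (fun d' hd' => ?_)).trans ?_)
      · obtain rfl : d' = d := by omega
        exact hd.marginal hint
      · have : (k : ℝ) ≤ N := by exact_mod_cast (Finset.mem_range.1 hk).le
        gcongr
    have h1 := Finset.sum_le_sum hkb
    rw [Finset.sum_const, Finset.card_range, nsmul_eq_mul] at h1
    calc _ ≤ _ := pow_le_pow_left₀ (Finset.sum_nonneg fun k _ => lpNorm_nonneg) h1 2
      _ = _ := by
        rw [mul_pow, Real.sq_sqrt (by positivity), show 2 * r - d + 1 = 2 + (2 * r - (d + 1)) by omega,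
          pow_add (N : ℝ) 2]
        ring
  · have hz : ∀ k, lpNorm (usum d k (marginal P h)) (2 * m : ℕ) (prodLaw P Q k) = 0 := fun k =>
      (lpNorm_eq_zero (hU k) (by exact_mod_cast (by omega : 2 * m ≠ 0))).2 (usum_congr_ae_zero
        ((hd.marginal hint).ae_eq_zero (measurable_marginal P hh) (hLm.integrable hone)))
    rw [Finset.sum_congr rfl fun k _ => hz k, Finset.sum_const_zero, zero_pow two_ne_zero]
    positivity

theorem measureReal_max_usum_le (hm : m ≠ 0) {h : (Fin (r + 1) → S) × T → ℝ}
    (hh : Measurable h) (hL : MemLp h (2 * m : ℕ) (prodLaw P Q (r + 1))) (hdr : d ≤ r)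
    (hd : IsDegenerate P Q d h)
    (hlaw : ∀ n, MeasurePreserving (initial X τ n) μ (prodLaw P Q n)) {l : ℝ} (hl : 0 < l) (N : ℕ) :
    μ.real {ω | ∃ n ≤ N, 2 * l < |usum (r + 1) n h (initial X τ n ω)|} ≤
      2 * ((16 * m) ^ (d + 1) * N ^ (2 * r - d + 1) *
        lpNorm h (2 * m : ℕ) (prodLaw P Q (r + 1)) ^ 2 / l ^ 2) ^ m := by
  obtain ⟨hC, hCle⟩ := lpNorm_sum_marginal_sq_le hm hh hL hdr hd hlaw N
  have h1 := measureReal_max_martPart_le hm hh hL hlaw hl N (lpNorm_martPart_sq_le hm hh hL hdr hd N)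
  have h2 := measureReal_le_of_lpNorm_sq_le hm hC hl hCle
  refine le_trans ?_ ((add_le_add h1 h2).trans_eq (two_mul _).symm)
  refine (measureReal_mono ?_).trans (measureReal_union_le _ _)
  rintro ω ⟨n, hn, hlt⟩
  by_contra hcon
  rw [Set.mem_union, not_or] at hcon
  obtain ⟨hc1, hc2⟩ := hcon
  have hc1' : |martPart P h n (initial X τ n ω)| < l := by
    by_contra hge
    exact hc1 ⟨n, hn, not_lt.1 hge⟩
  have hc2' : |(∑ k ∈ Finset.range N, |usum r k (marginal P h) (initial X τ k ω)|)| < l :=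
    not_le.1 hc2
  have h3 : |∑ k ∈ Finset.range n, usum r k (marginal P h) (initial X τ k ω)| ≤
      |(∑ k ∈ Finset.range N, |usum r k (marginal P h) (initial X τ k ω)|)| := by
    refine (Finset.abs_sum_le_sum_abs _ _).trans (le_trans ?_ (le_abs_self _))
    exact Finset.sum_le_sum_of_subset_of_nonneg (Finset.range_mono hn) fun _ _ _ => abs_nonneg _
  rw [usum_initial_eq (P := P)] at hlt
  have := abs_add_le (martPart P h n (initial X τ n ω))
    (∑ k ∈ Finset.range n, usum r k (marginal P h) (initial X τ k ω))
  linarith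

end Maximal

/-! ### From the probabilistic hypotheses to product laws. -/

section Hypotheses

variable {S : Type u} [MeasurableSpace S] {Ω : Type v} [MeasurableSpace Ω] {μ : Measure Ω}
  [IsProbabilityMeasure μ] {X : ℕ → Ω → S} {r d : ℕ}

/-- The one-point parameter space is the starting point of the recursion over parameter spaces. -/
theorem IsIID.measurePreserving (hX : IsIID X μ) {κ : Type*} [Fintype κ] {e : κ → ℕ}
    (he : Function.Injective e) :
    MeasurePreserving (fun ω => ((fun j => X (e j) ω, PUnit.unit) : (κ → S) × PUnit.{u + 1})) μ
      ((Measure.pi fun _ => μ.map (X 0)).prod (Measure.dirac PUnit.unit)) := by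
  have := hX.measurable
  have h1 := measurePreserving_tuple hX.measurable hX.indep
    (fun i => (hX.identDistrib i).map_eq) he
  refine ⟨by fun_prop, ?_⟩
  rw [Measure.prod_dirac, ← h1.map_eq, Measure.map_map (by fun_prop) h1.measurable]
  rfl

theorem exists_perm_extending (hdr : d ≤ r) {e : Fin d → Fin r} (he : Function.Injective e) :
    ∃ σ : Equiv.Perm (Fin r), ∀ j, σ (Fin.castLE hdr j) = e j := by
  classical
  have hc := Fin.castLE_injective hdr
  refine ⟨((Equiv.ofInjective _ hc).symm.trans (Equiv.ofInjective _ he)).extendSubtype, fun j => ?_⟩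
  rw [Equiv.extendSubtype_apply_of_mem _ _ ⟨j, rfl⟩]
  simp

theorem measurable_comp_tuple {Ω S T : Type*} {_ : MeasurableSpace Ω} [MeasurableSpace S]
    [MeasurableSpace T] {d : ℕ} {X : Fin d → Ω → S} {g : (Fin d → S) × T → ℝ} (hg : Measurable g)
    (hX : ∀ j, Measurable (X j)) (t : T) : Measurable fun ω => g (fun j => X j ω, t) := by
  fun_prop

/-- By symmetry and exchangeability any `d` chosen arguments may be taken to be `X 0, …, X (d - 1)`;
the test function is then measurable for `sigmaFirst X d` and can be pulled out of the conditional
expectation. -/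
theorem IsDegenerateOfOrder.isDegenerate {h : (Fin r → S) → ℝ} (hh : Measurable h)
    (hs : IsSymmetric h) (hX : IsIID X μ) (hd : IsDegenerateOfOrder h X μ d) :
    IsDegenerate (T := PUnit.{u + 1}) (μ.map (X 0)) (Measure.dirac PUnit.unit) d
      (fun p : (Fin r → S) × PUnit.{u + 1} => h p.1) := by
  intro e he g hg ⟨C, hC⟩
  have hdr : d ≤ r := by simpa using Fintype.card_le_of_injective e he
  have := hX.measurable
  obtain ⟨σ, hσ⟩ := exists_perm_extending hdr he
  -- Placing `X (σ⁻¹ j)` in slot `j` makes slot `e j` hold `X j`.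
  have hmp := hX.measurePreserving (κ := Fin r) (e := fun j => ((σ.symm j : Fin r) : ℕ))
    (Fin.val_injective.comp σ.symm.injective)
  rw [← integral_comp_measurePreserving (Measurable.aestronglyMeasurable (by fun_prop)) hmp]
  have hX' : ∀ ω, h (fun j => X (σ.symm j : Fin r) ω) = kernelVar h X ω := fun ω =>
    hs σ.symm fun j => X j ω
  have hσ' : ∀ j, σ.symm (e j) = Fin.castLE hdr j := fun j => by
    rw [← hσ j, Equiv.symm_apply_apply]
  simp only [hX', hσ', Fin.val_castLE]
  have hle : sigmaFirst X d ≤ (inferInstance : MeasurableSpace Ω) :=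
    iSup₂_le fun k _ => (hX.measurable k).comap_le
  have hXm : ∀ j : Fin d, Measurable[sigmaFirst X d] (X j) := fun j =>
    (comap_measurable (X j)).mono
      (le_iSup₂_of_le (j : ℕ) (Finset.mem_range.2 j.isLt) le_rfl) le_rfl
  have hGm : Measurable[sigmaFirst X d]
      (fun ω => g (fun j : Fin d => X j ω, PUnit.unit)) :=
    measurable_comp_tuple hg hXm _
  have hYG : Integrable (kernelVar h X * fun ω => g (fun j : Fin d => X j ω, PUnit.unit)) μ :=
    hd.integrable.mul_bdd (c := C) (hGm.mono hle le_rfl).aestronglyMeasurable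
      (Filter.Eventually.of_forall fun ω => hC _)
  have hce := condExp_mul_of_stronglyMeasurable_right hGm.stronglyMeasurable hYG hd.integrable
  have h1 := integral_condExp hle (f := kernelVar h X * fun ω => g (fun j : Fin d => X j ω, PUnit.unit))
    (μ := μ)
  refine Eq.trans (h1.symm.trans ?_) (integral_zero Ω ℝ (μ := μ))
  refine integral_congr_ae ?_
  filter_upwards [hce, hd.condExp_eq_zero] with ω h2 h3
  rw [h2, Pi.mul_apply, h3, Pi.zero_apply, zero_mul]

end Hypotheses

/-! ### Moments from the tail hypothesis. -/

section Tails

variable {Ω : Type*} [MeasurableSpace Ω] {μ : Measure Ω} [IsProbabilityMeasure μ] {Y : Ω → ℝ}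
  {γ : ℝ} {M : ℝ≥0}

/-- Layer-cake formula: levels `t ≤ 1` contribute at most `1`. Halving the exponent turns the tail
hypothesis into the integrable bound `M / t²` for `t > 1`, whose integral is `M`. -/
theorem lintegral_exp_rpow_half_le (hγ : 0 < γ) (hY : Measurable Y)
    (htail : ∀ t : ℝ, 0 < t → ENNReal.ofReal (Real.exp (t ^ γ)) * μ {ω | t < |Y ω|} ≤ M) :
    ∫⁻ ω, ENNReal.ofReal (Real.exp (|Y ω| ^ γ / 2)) ∂μ ≤ ENNReal.ofReal (1 + M) := by
  rw [lintegral_eq_lintegral_meas_lt μ (Filter.Eventually.of_forall fun ω => (Real.exp_pos _).le)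
    (by fun_prop : Measurable fun ω => Real.exp (|Y ω| ^ γ / 2)).aemeasurable,
    ← Set.Ioc_union_Ioi_eq_Ioi (zero_le_one (α := ℝ)),
    lintegral_union measurableSet_Ioi (Set.Ioc_disjoint_Ioi le_rfl),
    ENNReal.ofReal_add zero_le_one M.coe_nonneg]
  refine add_le_add ?_ ?_
  · calc ∫⁻ t in Set.Ioc (0 : ℝ) 1, μ {a | t < Real.exp (|Y a| ^ γ / 2)}
        ≤ ∫⁻ _ in Set.Ioc (0 : ℝ) 1, 1 := lintegral_mono fun t => prob_le_one
      _ = ENNReal.ofReal 1 := by simp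
  · have hbound : ∀ t ∈ Set.Ioi (1 : ℝ), μ {a | t < Real.exp (|Y a| ^ γ / 2)} ≤
        ENNReal.ofReal (M * t ^ (-2 : ℝ)) := fun t ht => by
      have ht1 : (1 : ℝ) < t := ht
      have ht0 : 0 < t := by linarith
      have hlog : 0 < 2 * Real.log t := by have := Real.log_pos ht1; linarith
      have h1 := htail ((2 * Real.log t) ^ γ⁻¹) (Real.rpow_pos_of_pos hlog _)
      rw [← Real.rpow_mul hlog.le, inv_mul_cancel₀ hγ.ne', Real.rpow_one, two_mul, Real.exp_add,
        Real.exp_log ht0] at h1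
      have hset : {a | t < Real.exp (|Y a| ^ γ / 2)} ⊆ {ω | (2 * Real.log t) ^ γ⁻¹ < |Y ω|} := by
        intro ω hω
        have h2 : Real.log t < |Y ω| ^ γ / 2 := (Real.log_lt_iff_lt_exp ht0).2 hω
        have h3 : (2 * Real.log t) ^ γ⁻¹ < (|Y ω| ^ γ) ^ γ⁻¹ :=
          Real.rpow_lt_rpow hlog.le (by linarith) (inv_pos.2 hγ)
        rwa [← Real.rpow_mul (abs_nonneg _), mul_inv_cancel₀ hγ.ne', Real.rpow_one] at h3
      refine (measure_mono hset).trans ?_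
      have hpos : ENNReal.ofReal (t * t) ≠ 0 := by simp [ht0]
      rw [mul_comm, ← two_mul] at h1
      rw [← ENNReal.le_div_iff_mul_le (Or.inl hpos) (Or.inl ENNReal.ofReal_ne_top)] at h1
      refine h1.trans_eq ?_
      rw [← ENNReal.ofReal_coe_nnreal, ← ENNReal.ofReal_div_of_pos (by positivity),
        Real.rpow_neg ht0.le, Real.rpow_two]
      congr 1
      rw [div_eq_mul_inv, sq]
    calc ∫⁻ t in Set.Ioi (1 : ℝ), μ {a | t < Real.exp (|Y a| ^ γ / 2)}
        ≤ ∫⁻ t in Set.Ioi (1 : ℝ), ENNReal.ofReal (M * t ^ (-2 : ℝ)) :=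
          setLIntegral_mono' measurableSet_Ioi hbound
      _ = ENNReal.ofReal (∫ t in Set.Ioi (1 : ℝ), M * t ^ (-2 : ℝ)) := by
          refine (ofReal_integral_eq_lintegral_ofReal ?_ ?_).symm
          · exact (integrableOn_Ioi_rpow_of_lt (by norm_num) one_pos).const_mul _
          · refine (ae_restrict_iff' measurableSet_Ioi).2 (Filter.Eventually.of_forall fun t ht => ?_)
            have : (0 : ℝ) < t := lt_trans one_pos ht
            positivity
      _ = ENNReal.ofReal M := by
          rw [integral_const_mul, integral_Ioi_rpow_of_lt (by norm_num) one_pos]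
          norm_num
      _ ≤ _ := le_rfl

/-- Raise `u ≤ exp u`, with `u = |y| ^ γ / (2q)`, to the power `q = 2m / γ`. -/
theorem abs_pow_le_exp_rpow (hγ : 0 < γ) {m : ℕ} (hm : m ≠ 0) (y : ℝ) :
    y ^ (2 * m) ≤ (4 * m / γ) ^ (2 * m / γ) * Real.exp (|y| ^ γ / 2) := by
  have hm0 : (0 : ℝ) < m := by exact_mod_cast Nat.pos_of_ne_zero hm
  have hq : 0 < 2 * m / γ := by positivity
  set q := 2 * m / γ with hqdef
  have h0 : 0 ≤ |y| ^ γ := Real.rpow_nonneg (abs_nonneg _) _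
  have h1 : |y| ^ γ ≤ 4 * m / γ * Real.exp (|y| ^ γ / 2 / q) := by
    have h2 := Real.add_one_le_exp (|y| ^ γ / 2 / q)
    have h3 : |y| ^ γ = 4 * m / γ * (|y| ^ γ / 2 / q) := by
      rw [hqdef]
      field_simp
      ring
    have h4 : 0 < 4 * m / γ := by positivity
    calc |y| ^ γ = 4 * m / γ * (|y| ^ γ / 2 / q) := h3
      _ ≤ _ := by gcongr; linarith
  have h5 := Real.rpow_le_rpow h0 h1 hq.le
  rw [Real.mul_rpow (by positivity) (Real.exp_pos _).le, ← Real.exp_mul,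
    div_mul_cancel₀ _ hq.ne', ← Real.rpow_mul (abs_nonneg _)] at h5
  have h6 : γ * q = (2 * m : ℕ) := by
    rw [hqdef]
    push_cast
    field_simp
  rwa [h6, Real.rpow_natCast, (even_two_mul m).pow_abs] at h5

theorem memLp_of_tail (hγ : 0 < γ) (hY : Measurable Y)
    (htail : ∀ t : ℝ, 0 < t → ENNReal.ofReal (Real.exp (t ^ γ)) * μ {ω | t < |Y ω|} ≤ M)
    {m : ℕ} (hm : m ≠ 0) :
    MemLp Y (2 * m : ℕ) μ ∧
      lpNorm Y (2 * m : ℕ) μ ^ 2 ≤ (4 / γ) ^ (2 / γ) * (1 + M) * (m : ℝ) ^ (2 / γ) := by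
  have hm0 : (0 : ℝ) < m := by exact_mod_cast Nat.pos_of_ne_zero hm
  have hexp := lintegral_exp_rpow_half_le hγ hY htail
  have hEint : Integrable (fun ω => Real.exp (|Y ω| ^ γ / 2)) μ := by
    refine ⟨(by fun_prop : Measurable fun ω => Real.exp (|Y ω| ^ γ / 2)).aestronglyMeasurable, ?_⟩
    rw [hasFiniteIntegral_iff_ofReal (Filter.Eventually.of_forall fun ω => (Real.exp_pos _).le)]
    exact hexp.trans_lt ENNReal.ofReal_lt_top
  have hEle : ∫ ω, Real.exp (|Y ω| ^ γ / 2) ∂μ ≤ 1 + M := by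
    rw [integral_eq_lintegral_of_nonneg_ae
      (Filter.Eventually.of_forall fun ω => (Real.exp_pos _).le) hEint.1]
    exact ENNReal.toReal_le_of_le_ofReal (by positivity) hexp
  have hint : Integrable (fun ω => Y ω ^ (2 * m)) μ := by
    refine Integrable.mono' (hEint.const_mul ((4 * m / γ) ^ (2 * m / γ)))
      (hY.pow_const _).aestronglyMeasurable (Filter.Eventually.of_forall fun ω => ?_)
    rw [Real.norm_of_nonneg ((even_two_mul m).pow_nonneg _)]
    exact abs_pow_le_exp_rpow hγ hm _
  refine ⟨(memLp_even_iff hY.aestronglyMeasurable hm).2 hint, ?_⟩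
  refine le_of_pow_le_pow_left₀ hm (by positivity) ?_
  rw [← pow_mul, lpNorm_even_pow hY.aestronglyMeasurable hm]
  have hM1 : (1 : ℝ) ≤ 1 + M := by simp
  calc ∫ ω, Y ω ^ (2 * m) ∂μ
      ≤ ∫ ω, (4 * m / γ) ^ (2 * m / γ) * Real.exp (|Y ω| ^ γ / 2) ∂μ :=
        integral_mono hint (hEint.const_mul _) fun ω => abs_pow_le_exp_rpow hγ hm _
    _ ≤ (4 * m / γ) ^ (2 * m / γ) * (1 + M) ^ m := by
        rw [integral_const_mul]
        gcongr
        -- Enlarging `1 + M` to its `m`-th power lets the `m`-th root be taken with a constant free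
        -- of `m`.
        exact hEle.trans (le_self_pow₀ hM1 hm)
    _ = _ := by
        rw [show 2 * m / γ = 2 / γ * (m : ℝ) by ring, Real.rpow_mul (by positivity),
          Real.rpow_natCast, ← mul_pow, show 4 * m / γ = 4 / γ * (m : ℝ) by ring,
          Real.mul_rpow (by positivity) (by positivity)]
        ring

end Tails

/-! ### Choice of the moment order, and the conclusion. -/

/-- With `θ = γ / (2 + iγ)`, one has `θ ≤ γ / 2` and `iθ ≤ 1`, so `A ^ θ` and `16 ^ (iθ)` are
bounded independently of `i`; hence the constant does not depend on `i`. -/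
theorem rpow_optimal_scale {γ A x : ℝ} (hγ : 0 < γ) (hA : 1 ≤ A) (hx : 0 < x) {N i : ℕ} (hN : 0 < N) :
    1 / (16 * A ^ (γ / 2)) * (N : ℝ) ^ (i * γ / (2 + i * γ)) * x ^ (2 * γ / (2 + i * γ)) ≤
      ((N : ℝ) ^ i * x ^ 2 / (A * 16 ^ i)) ^ (i + 2 / γ)⁻¹ := by
  have hN0 : (0 : ℝ) < N := by exact_mod_cast hN
  have hi0 : (0 : ℝ) ≤ i := i.cast_nonneg
  have hden : 0 < 2 + i * γ := by positivity
  have hθ : ((i : ℝ) + 2 / γ)⁻¹ = γ / (2 + i * γ) := by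
    field_simp
    ring
  rw [hθ, Real.div_rpow (by positivity) (by positivity),
    Real.mul_rpow (by positivity) (by positivity), Real.mul_rpow (by positivity) (by positivity),
    ← Real.rpow_natCast, ← Real.rpow_natCast x 2, ← Real.rpow_natCast 16 i,
    ← Real.rpow_mul hN0.le, ← Real.rpow_mul hx.le, ← Real.rpow_mul (by norm_num)]
  have h1 : A ^ (γ / (2 + i * γ)) ≤ A ^ (γ / 2) := by
    refine Real.rpow_le_rpow_of_exponent_le hA ?_
    refine div_le_div_of_nonneg_left hγ.le two_pos ?_
    have : 0 ≤ i * γ := by positivity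
    linarith
  have h2 : (16 : ℝ) ^ (i * (γ / (2 + i * γ))) ≤ 16 := by
    refine (Real.rpow_le_rpow_of_exponent_le (by norm_num) ?_).trans_eq (Real.rpow_one 16)
    rw [← mul_div_assoc, div_le_one hden]
    linarith
  rw [← mul_div_assoc, ← mul_div_assoc, Nat.cast_ofNat, mul_assoc, one_div_mul_eq_div]
  rw [← mul_div_assoc] at h2
  rw [mul_comm (16 : ℝ)]
  gcongr

theorem exists_moment_le {Θ Z K p : ℝ} (hΘ : 0 < Θ) (hZ : 0 ≤ Z) (hK : K ≤ Z ^ Θ⁻¹) (hp1 : p ≤ 1)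
    (hp : ∀ m : ℕ, m ≠ 0 → (m : ℝ) ^ Θ ≤ Z → p ≤ 2 * Real.exp (-2) ^ m) :
    p ≤ 3 * Real.exp (-K) := by
  set R := Z ^ Θ⁻¹ with hR
  have hR0 : 0 ≤ R := Real.rpow_nonneg hZ _
  have hmono : Real.exp (-R) ≤ Real.exp (-K) := Real.exp_le_exp.2 (by linarith)
  -- For `R < 1` no positive `m` need be admissible, but the claim is trivial because `3 / e ≥ 1`.
  -- Otherwise `m = ⌊R⌋ ≥ 1` gives `2m ≥ m + 1 > R`, so `exp (-2) ^ m ≤ exp (-R)`.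
  rcases lt_or_ge R 1 with hlt | hge
  · have h1 : Real.exp (-1) ≤ Real.exp (-R) := Real.exp_le_exp.2 (by linarith)
    have h2 : 1 ≤ 3 * Real.exp (-1) := by
      rw [Real.exp_neg, ← div_eq_mul_inv, le_div_iff₀ (Real.exp_pos 1)]
      have := Real.exp_one_lt_d9
      linarith
    linarith
  · have hm1 : 1 ≤ ⌊R⌋₊ := Nat.le_floor (by simpa using hge)
    have hmR : (⌊R⌋₊ : ℝ) ≤ R := Nat.floor_le hR0
    have h1 : (⌊R⌋₊ : ℝ) ^ Θ ≤ Z := by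
      refine (Real.rpow_le_rpow (Nat.cast_nonneg _) hmR hΘ.le).trans_eq ?_
      rw [hR, ← Real.rpow_mul hZ, inv_mul_cancel₀ hΘ.ne', Real.rpow_one]
    have h2 := hp ⌊R⌋₊ (by omega) h1
    rw [← Real.exp_nat_mul] at h2
    have h3 : R < ⌊R⌋₊ + 1 := Nat.lt_floor_add_one R
    have h4 : (1 : ℝ) ≤ ⌊R⌋₊ := by exact_mod_cast hm1
    have h5 : Real.exp (⌊R⌋₊ * -2) ≤ Real.exp (-R) := Real.exp_le_exp.2 (by linarith)
    have h6 := Real.exp_pos (-R)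
    linarith

section Main

variable {S : Type u} [MeasurableSpace S] {Ω : Type v} [MeasurableSpace Ω] {μ : Measure Ω}
  [IsProbabilityMeasure μ] {X : ℕ → Ω → S} {r d : ℕ}

theorem measureReal_maxUStat_le {h : (Fin (r + 1) → S) → ℝ} (hh : Measurable h)
    (hs : IsSymmetric h) (hX : IsIID X μ) (hd : IsDegenerateOfOrder h X μ d) (hdr : d ≤ r)
    {m : ℕ} (hm : m ≠ 0) (hY : MemLp (kernelVar h X) (2 * m : ℕ) μ) {N : ℕ} (hN : r + 1 ≤ N) {l : ℝ}
    (hl : 0 < l) :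
    μ.real {ω | 2 * l < maxUStat h X hN ω} ≤
      2 * ((16 * m) ^ (d + 1) * N ^ (2 * r - d + 1) *
        lpNorm (kernelVar h X) (2 * m : ℕ) μ ^ 2 / l ^ 2) ^ m := by
  have := Measure.isProbabilityMeasure_map (μ := μ) (hX.measurable 0).aemeasurable
  have hdeg := hd.isDegenerate hh hs hX
  have hlaw : ∀ n, MeasurePreserving (initial X (fun _ => PUnit.unit.{u + 1}) n) μ
      (prodLaw (μ.map (X 0)) (Measure.dirac PUnit.unit.{u + 1}) n) :=
    fun n => hX.measurePreserving (κ := Fin n) Fin.val_injective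
  have hmeas : Measurable (fun p : (Fin (r + 1) → S) × PUnit.{u + 1} => h p.1) := by fun_prop
  have hlp := lpNorm_comp_measurePreserving (p := (2 * m : ℕ)) hmeas.aestronglyMeasurable
    (hlaw (r + 1))
  have hL : MemLp (fun p : (Fin (r + 1) → S) × PUnit.{u + 1} => h p.1) (2 * m : ℕ)
      (prodLaw (μ.map (X 0)) (Measure.dirac PUnit.unit.{u + 1}) (r + 1)) := by
    rw [← (hlaw (r + 1)).map_eq]
    exact (memLp_map_measure_iff hmeas.aestronglyMeasurable (hlaw (r + 1)).aemeasurable).2 hY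
  have hmax := measureReal_max_usum_le hm hmeas hL hdr hdeg hlaw hl N
  rw [← hlp] at hmax
  refine (measureReal_mono ?_).trans hmax
  intro ω hω
  rw [Set.mem_ofPred_eq, maxUStat, Finset.lt_sup'_iff] at hω
  obtain ⟨n, hn, hlt⟩ := hω
  exact ⟨n, (Finset.mem_Icc.1 hn).2, hlt⟩

end Main

end UStat

theorem mainTheorem5 (γ : ℝ) (hγ : 0 < γ) (M : ℝ≥0) :
    ∃ K₁ K₂ : ℝ, 0 < K₁ ∧ 0 < K₂ ∧
      ∀ (Ω : Type*) [MeasurableSpace Ω] (μ : Measure Ω) [IsProbabilityMeasure μ]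
        (S : Type*) [MeasurableSpace S] (r i : ℕ) (h : (Fin r → S) → ℝ) (X : ℕ → Ω → S),
        2 ≤ i → i ≤ r →
        Measurable h → UStat.IsSymmetric h → UStat.IsIID X μ →
        UStat.IsDegenerateOfOrder h X μ (i - 1) →
        UStat.tailSup h X μ γ = (M : ℝ≥0∞) →
        ∀ (N : ℕ) (hN : r ≤ N) (x : ℝ), 0 < x →
          μ.real {ω | (N : ℝ) ^ r * x < UStat.maxUStat h X hN ω} ≤
            K₁ * Real.exp (-(K₂ * (N : ℝ) ^ ((i * γ) / (2 + i * γ)) *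
              x ^ ((2 * γ) / (2 + i * γ)))) := by
  set A₀ : ℝ := (4 / γ) ^ (2 / γ) * (1 + M) with hA₀
  have hA₀pos : 0 < A₀ := by positivity
  -- The factor `4` comes from the level `N ^ r * x / 2`, and `exp 2` brings the base of the `m`-th
  -- power down to `exp (-2)`. Adding `1` ensures `A ≥ 1`, which is needed for uniformity in `i`.
  set A : ℝ := 1 + 4 * Real.exp 2 * A₀ with hA
  have hA1 : 1 ≤ A := by
    have : 0 ≤ 4 * Real.exp 2 * A₀ := by positivity
    linarith
  refine ⟨3, 1 / (16 * A ^ (γ / 2)), by norm_num, by positivity, ?_⟩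
  intro Ω _ μ _ S _ r i h X hi hir hh hs hX hd htail N hN x hx
  obtain ⟨d, rfl⟩ : ∃ d, i = d + 1 := ⟨i - 1, by omega⟩
  obtain ⟨r, rfl⟩ : ∃ k, r = k + 1 := ⟨r - 1, by omega⟩
  rw [Nat.add_sub_cancel] at hd
  have hN0 : (0 : ℝ) < N := by exact_mod_cast (by omega : 0 < N)
  have hYm : Measurable (UStat.kernelVar h X) := by
    have := hX.measurable
    unfold UStat.kernelVar
    fun_prop
  have htail' : ∀ t : ℝ, 0 < t →
      ENNReal.ofReal (Real.exp (t ^ γ)) * μ {ω | t < |UStat.kernelVar h X ω|} ≤ M := fun t ht => by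
    rw [← htail]
    exact le_iSup₂ (f := fun (t : ℝ) (_ : 0 < t) =>
      ENNReal.ofReal (Real.exp (t ^ γ)) * μ {ω | t < |UStat.kernelVar h X ω|}) t ht
  refine UStat.exists_moment_le (Θ := ((d + 1 : ℕ) : ℝ) + 2 / γ)
    (Z := (N : ℝ) ^ (d + 1) * x ^ 2 / (A * 16 ^ (d + 1))) (by positivity) (by positivity)
    (UStat.rpow_optimal_scale hγ hA1 hx (by omega)) measureReal_le_one fun m hm hmZ => ?_
  have hm0 : (0 : ℝ) < m := by exact_mod_cast Nat.pos_of_ne_zero hm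
  obtain ⟨hY, hYle⟩ := UStat.memLp_of_tail hγ hYm htail' hm
  -- The level is halved because martingale and drift each receive half of the threshold.
  have hmain := UStat.measureReal_maxUStat_le hh hs hX hd (by omega) hm hY hN
    (l := (N : ℝ) ^ (r + 1) * x / 2) (by positivity)
  rw [mul_div_cancel₀ _ (two_ne_zero' ℝ)] at hmain
  refine hmain.trans ?_
  gcongr
  rw [Real.rpow_add hm0, Real.rpow_natCast, le_div_iff₀ (by positivity)] at hmZ
  rw [div_le_iff₀ (by positivity)]
  calc (16 * m : ℝ) ^ (d + 1) * N ^ (2 * r - d + 1) *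
        lpNorm (UStat.kernelVar h X) (2 * m : ℕ) μ ^ 2
      ≤ (16 * m : ℝ) ^ (d + 1) * N ^ (2 * r - d + 1) * (A₀ * (m : ℝ) ^ (2 / γ)) := by gcongr
    _ = Real.exp (-2) * (N ^ (2 * r - d + 1) * ((m : ℝ) ^ (d + 1) * (m : ℝ) ^ (2 / γ) *
          ((4 * Real.exp 2 * A₀) * 16 ^ (d + 1)))) / 4 := by
        rw [Real.exp_neg]
        field_simp
        ring
    _ ≤ Real.exp (-2) * (N ^ (2 * r - d + 1) * ((m : ℝ) ^ (d + 1) * (m : ℝ) ^ (2 / γ) *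
          (A * 16 ^ (d + 1)))) / 4 := by
        gcongr
        linarith
    _ ≤ Real.exp (-2) * (N ^ (2 * r - d + 1) * (N ^ (d + 1) * x ^ 2)) / 4 := by gcongr
    _ = Real.exp (-2) * ((N : ℝ) ^ (r + 1) * x / 2) ^ 2 := by
        have : (N : ℝ) ^ (2 * r - d + 1) * N ^ (d + 1) = (N ^ (r + 1)) ^ 2 := by
          rw [← pow_add, ← pow_mul]
          congr 1
          omega
        linear_combination (Real.exp (-2) * x ^ 2 / 4) * this
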